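/- Let $\Bbbk$ be a field, $H$ a Hopf algebra over $\Bbbk$ with antipode $S$, and $A$ a right $H$-comodule algebra: a unital associative algebra with a coaction $\varrho^A:A\to A\otimes H$, $a\mapsto a_{(0)}\otimes a_{(1)}$, that is an algebra map. Put $B=A^{coH}=\{b\in A\mid \varrho^A(b)=b\otimes 1\}$. Assume that $A$ is a principal comodule algebra, that is: $S$ is bijective; the canonical map $A\otimes_BA\to A\otimes H$, $a\otimes_B a'\mapsto a\varrho^A(a')$, is bijective; and the multiplication map $B\otimes A\to A$ has a left $B$-linear right $H$-colinear splitting $s:A\to B\otimes A$ (where $B\otimes A$ has the coaction $\mathrm{id}\otimes\varrho^A$). For an algebra $R$ write $\Omega^1_u(R)=\ker(R\otimes R\to R)$ with the universal differential $d:R\to\Omega^1_u(R)$, $d(r)=1\otimes r-r\otimes 1$; this is the degree-one part of the universal differential graded algebra $\Omega R$. View $\Omega^1_u(A)$ as an $H$-comodule by restriction of the diagonal coaction $a\otimes a'\mapsto a_{(0)}\otimes a'_{(0)}\otimes a_{(1)}a'_{(1)}$, identify $\Omega^1_u(B)$ with its image in $\Omega^1_u(A)$, and let $(\Omega^1_u(B))A\subseteq\Omega^1_u(A)$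 be the right $A$-submodule it generates. Let $\mathcal M_A^H$ be the category of $(A,H)$-relative Hopf modules (right $A$-modules and right $H$-comodules $M$ with $\varrho^M(ma)=m_{(0)}a_{(0)}\otimes m_{(1)}a_{(1)}$), with right $A$-linear right $H$-colinear maps, and let ${}_B\mathcal M_A^H$ be the category of those objects of $\mathcal M_A^H$ that carry a left $B$-action by right $A$-linear right $H$-colinear maps, with the $B$-linear morphisms of $\mathcal M_A^H$. For $M\in\mathcal M_A^H$ put $M^{coH}=\{m\mid\varrho^M(m)=m\otimes1\}$, a right $B$-module. A hom-connection on a right $R$-module $N$ with respect to $\Omega R$ is a $\Bbbk$-linear map $\nabla:\mathrm{Hom}_R(\Omega^1_u(R),N)\to N$ with $\nabla(fr)=\nabla(f)r+f(dr)$ for all $f$ and all $r\in R$, where $\mathrm{Hom}_R$ denotes right $R$-linear maps and $(fr)(\omega)=f(r\omega)$. 1. $\Omega^1_u(A)$ and $(\Omega^1_u(B))A$ are objects of ${}_B\mathcal M_A^H$, and $(\Omega^1_u(B))A$ is a direct summand of $\Omega^1_u(A)$ in ${}_B\mathcal M_A^H$: there is a morphism $\Pi:\Omega^1_u(A)\to(\Omega^1_u(B))A$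 in ${}_B\mathcal M_A^H$ that restricts to the identity on $(\Omega^1_u(B))A$. 2. Let $\Pi$ be any such morphism, let $M\in\mathcal M_A^H$, and let $\nabla$ be a hom-connection on $M$ with respect to $\Omega A$ such that $\nabla(f)\in M^{coH}$ for every right $A$-linear right $H$-colinear $f:\Omega^1_u(A)\to M$. Then every right $B$-linear map $f:\Omega^1_u(B)\to M^{coH}$ extends uniquely to a morphism $\widehat f:(\Omega^1_u(B))A\to M$ in $\mathcal M_A^H$, and $$\nabla^{coH}(f)=\nabla(\widehat f\circ\Pi)$$ defines a hom-connection $\nabla^{coH}:\mathrm{Hom}_B(\Omega^1_u(B),M^{coH})\to M^{coH}$ on $M^{coH}$ with respect to $\Omega B$. -/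

import Mathlib

open scoped TensorProduct
open MulOpposite

namespace HopfGalois

/-! ### Comodules, comodule algebras, relative Hopf modules

Right modules over a ring `A` are modules over `Aᵐᵒᵖ`: `op a • m` is `m a`. -/

/-- A right comodule `M` over a coalgebra `H` over the field `k`. -/
class RightComodule (k H M : Type*) [Field k] [Ring H] [HopfAlgebra k H]
    [AddCommGroup M] [Module k M] where
  /-- the coaction `m ↦ m₍₀₎ ⊗ m₍₁₎` -/
  coact : M →ₗ[k] M ⊗[k] H
  /-- `(ϱ ⊗ id) ϱ = (id ⊗ Δ) ϱ` -/
  coassoc : ∀ m, TensorProduct.assoc k M H H (coact.rTensor H (coact m)) =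
    (Coalgebra.comul (R := k) (A := H)).lTensor M (coact m)
  /-- `(id ⊗ ε) ϱ = id` -/
  counit_coact : ∀ m, TensorProduct.rid k M
    ((Coalgebra.counit (R := k) (A := H)).lTensor M (coact m)) = m

/-- The coaction of a right `H`-comodule. -/
abbrev coact (k H : Type*) {M : Type*} [Field k] [Ring H] [HopfAlgebra k H]
    [AddCommGroup M] [Module k M] [RightComodule k H M] : M →ₗ[k] M ⊗[k] H :=
  RightComodule.coact

/-- Right `H`-colinear maps: `ϱ (f x) = (f ⊗ id) (ϱ x)`. -/
def IsColinear (k H : Type*) {M N : Type*} [Field k] [Ring H] [HopfAlgebra k H]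
    [AddCommGroup M] [Module k M] [RightComodule k H M]
    [AddCommGroup N] [Module k N] [RightComodule k H N] (f : M →ₗ[k] N) : Prop :=
  ∀ x, coact k H (f x) = f.rTensor H (coact k H x)

/-- A right `H`-comodule algebra: the coaction `A → A ⊗ H` is a map of algebras. -/
class IsComoduleAlgebra (k H A : Type*) [Field k] [Ring H] [HopfAlgebra k H]
    [Ring A] [Algebra k A] [RightComodule k H A] : Prop where
  coact_one : coact k H (1 : A) = 1
  coact_mul : ∀ a b : A, coact k H (a * b) = coact k H a * coact k H b

/-- The right action of an algebra `A` on a right module `M` as a bilinear map `m, a ↦ m a`. -/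
def rightAct (k A M : Type*) [Field k] [Ring A] [Algebra k A] [AddCommGroup M] [Module k M]
    [Module Aᵐᵒᵖ M] [IsScalarTower k Aᵐᵒᵖ M] : M →ₗ[k] A →ₗ[k] M :=
  LinearMap.mk₂ k (fun m a => op a • m)
    (fun m n a => smul_add _ m n)
    (fun c m a => smul_comm _ c m)
    (fun m a b => by rw [op_add, add_smul])
    (fun c m a => by rw [op_smul, smul_assoc])

/-- The diagonal right action `(m ⊗ h) (a ⊗ g) = m a ⊗ h g` of `A ⊗ H` on `M ⊗ H`. -/
noncomputable def diagAct (k H A M : Type*) [Field k] [Ring H] [HopfAlgebra k H]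
    [Ring A] [Algebra k A] [AddCommGroup M] [Module k M]
    [Module Aᵐᵒᵖ M] [IsScalarTower k Aᵐᵒᵖ M] :
    M ⊗[k] H →ₗ[k] A ⊗[k] H →ₗ[k] M ⊗[k] H :=
  TensorProduct.map₂ (rightAct k A M) (LinearMap.mul k H)

/-- `(A, H)`-relative Hopf modules, i.e. objects of the category `M_A^H`:
`ϱ (m a) = m₍₀₎ a₍₀₎ ⊗ m₍₁₎ a₍₁₎`. -/
class IsHopfModule (k H A M : Type*) [Field k] [Ring H] [HopfAlgebra k H]
    [Ring A] [Algebra k A] [RightComodule k H A] [AddCommGroup M] [Module k M]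
    [Module Aᵐᵒᵖ M] [IsScalarTower k Aᵐᵒᵖ M] [RightComodule k H M] : Prop where
  coact_smul : ∀ (m : M) (a : A),
    coact k H (op a • m) = diagAct k H A M (coact k H m) (coact k H a)

/-- The coaction on `N` induced along an injective map `ι : N → M` whose image is stable under a
coaction `ρ` on `M`: the unique map with `(ι ⊗ id) ϱ = ρ ι`. -/
noncomputable def restrictCoact {k H M N : Type*} [Field k] [Ring H] [HopfAlgebra k H]
    [AddCommGroup M] [Module k M] [AddCommGroup N] [Module k N] (ρ : M →ₗ[k] M ⊗[k] H)
    (ι : N →ₗ[k] M) (hι : Function.Injective ι)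
    (h : ∀ n, ρ (ι n) ∈ LinearMap.range (ι.rTensor H)) : N →ₗ[k] N ⊗[k] H :=
  (LinearEquiv.ofInjective (ι.rTensor H)
    (Module.Flat.rTensor_preserves_injective_linearMap ι hι)).symm.toLinearMap ∘ₗ
    (ρ ∘ₗ ι).codRestrict _ h

theorem rTensor_restrictCoact {k H M N : Type*} [Field k] [Ring H] [HopfAlgebra k H]
    [AddCommGroup M] [Module k M] [AddCommGroup N] [Module k N] (ρ : M →ₗ[k] M ⊗[k] H)
    (ι : N →ₗ[k] M) (hι : Function.Injective ι)
    (h : ∀ n, ρ (ι n) ∈ LinearMap.range (ι.rTensor H)) (n : N) :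
    ι.rTensor H (restrictCoact ρ ι hι h n) = ρ (ι n) := by
  have := LinearEquiv.apply_symm_apply (LinearEquiv.ofInjective (ι.rTensor H)
    (Module.Flat.rTensor_preserves_injective_linearMap ι hι)) ((ρ ∘ₗ ι).codRestrict _ h n)
  exact congrArg Subtype.val this

theorem lTensor_rTensor_comm {k M N P Q : Type*} [Field k] [AddCommGroup M] [Module k M]
    [AddCommGroup N] [Module k N] [AddCommGroup P] [Module k P] [AddCommGroup Q] [Module k Q]
    (f : N →ₗ[k] M) (g : P →ₗ[k] Q) (t : N ⊗[k] P) :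
    g.lTensor M (f.rTensor P t) = f.rTensor Q (g.lTensor N t) := by
  rw [← LinearMap.comp_apply, ← LinearMap.comp_apply, LinearMap.lTensor_comp_rTensor,
    LinearMap.rTensor_comp_lTensor]

/-- The comodule structure on `N` given by `restrictCoact`. -/
noncomputable abbrev RightComodule.ofInjective {k H M N : Type*} [Field k] [Ring H]
    [HopfAlgebra k H] [AddCommGroup M] [Module k M] [AddCommGroup N] [Module k N]
    (ρ : M →ₗ[k] M ⊗[k] H)
    (hco : ∀ m, TensorProduct.assoc k M H H (ρ.rTensor H (ρ m)) =
      (Coalgebra.comul (R := k) (A := H)).lTensor M (ρ m))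
    (hcu : ∀ m, TensorProduct.rid k M
      ((Coalgebra.counit (R := k) (A := H)).lTensor M (ρ m)) = m)
    (ι : N →ₗ[k] M) (hι : Function.Injective ι)
    (h : ∀ n, ρ (ι n) ∈ LinearMap.range (ι.rTensor H)) : RightComodule k H N where
  coact := restrictCoact ρ ι hι h
  coassoc n := by
    apply Module.Flat.rTensor_preserves_injective_linearMap (M := H ⊗[k] H) ι hι
    have e1 : ∀ t : (N ⊗[k] H) ⊗[k] H, ι.rTensor (H ⊗[k] H) (TensorProduct.assoc k N H H t) =
        TensorProduct.assoc k M H H ((ι.rTensor H).rTensor H t) := by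
      intro t
      have : ι.rTensor (H ⊗[k] H) ∘ₗ (TensorProduct.assoc k N H H).toLinearMap =
        (TensorProduct.assoc k M H H).toLinearMap ∘ₗ (ι.rTensor H).rTensor H := by
        ext; simp
      exact LinearMap.congr_fun this t
    have e2 : (ι.rTensor H) ∘ₗ restrictCoact ρ ι hι h = ρ ∘ₗ ι :=
      LinearMap.ext (rTensor_restrictCoact ρ ι hι h)
    rw [e1, ← LinearMap.rTensor_comp_apply, e2, LinearMap.rTensor_comp_apply,
      rTensor_restrictCoact, hco]
    rw [← rTensor_restrictCoact ρ ι hι h n]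
    exact lTensor_rTensor_comm _ _ _
  counit_coact n := by
    apply hι
    have e1 : ∀ t : N ⊗[k] k, ι (TensorProduct.rid k N t) =
        TensorProduct.rid k M (ι.rTensor k t) := by
      intro t
      have : ι ∘ₗ (TensorProduct.rid k N).toLinearMap =
        (TensorProduct.rid k M).toLinearMap ∘ₗ ι.rTensor k := by
        ext; simp
      exact LinearMap.congr_fun this t
    rw [e1]
    conv_rhs => rw [← hcu (ι n), ← rTensor_restrictCoact ρ ι hι h n]
    congr 1
    exact (lTensor_rTensor_comm _ _ _).symm

/-! ### Coinvariants -/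

/-- The subalgebra `B = A^{coH} = {b | ϱ b = b ⊗ 1}` of coinvariants. -/
def coinvAlg (k H A : Type*) [Field k] [Ring H] [HopfAlgebra k H]
    [Ring A] [Algebra k A] [RightComodule k H A] [IsComoduleAlgebra k H A] : Subalgebra k A where
  carrier := {b | coact k H b = b ⊗ₜ[k] (1 : H)}
  mul_mem' {a b} ha hb := by
    change coact k H _ = _ at *
    rw [IsComoduleAlgebra.coact_mul, ha, hb, Algebra.TensorProduct.tmul_mul_tmul, mul_one]
  add_mem' {a b} ha hb := by
    change coact k H _ = _ at *
    rw [map_add, ha, hb, TensorProduct.add_tmul]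
  algebraMap_mem' r := by
    change coact k H _ = _
    rw [Algebra.algebraMap_eq_smul_one, map_smul, IsComoduleAlgebra.coact_one,
      Algebra.TensorProduct.one_def, TensorProduct.smul_tmul']

/-- The space `M^{coH} = {m | ϱ m = m ⊗ 1}` of coinvariants of a comodule. -/
def coinv (k H M : Type*) [Field k] [Ring H] [HopfAlgebra k H]
    [AddCommGroup M] [Module k M] [RightComodule k H M] : Submodule k M where
  carrier := {m | coact k H m = m ⊗ₜ[k] (1 : H)}
  add_mem' {a b} ha hb := by
    change coact k H _ = _ at *
    rw [map_add, ha, hb, TensorProduct.add_tmul]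
  zero_mem' := by simp
  smul_mem' c m hm := by
    change coact k H _ = _ at *
    rw [map_smul, hm, TensorProduct.smul_tmul']

section CoinvModule

variable (k H A M : Type*) [Field k] [Ring H] [HopfAlgebra k H]
  [Ring A] [Algebra k A] [RightComodule k H A] [IsComoduleAlgebra k H A]
  [AddCommGroup M] [Module k M] [Module Aᵐᵒᵖ M] [IsScalarTower k Aᵐᵒᵖ M]
  [RightComodule k H M] [IsHopfModule k H A M]

/-- For a Hopf module `M`, the action of `A` restricts to a right action of `B = A^{coH}` on
`M^{coH}`. -/
instance coinvModule : Module (coinvAlg k H A)ᵐᵒᵖ (coinv k H M) where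
  smul b m := ⟨op (b.unop).val • (m : M), by
    have hb : coact k H (b.unop).val = (b.unop).val ⊗ₜ[k] (1 : H) := (b.unop).2
    have hm : coact k H (m : M) = (m : M) ⊗ₜ[k] (1 : H) := m.2
    change coact k H _ = _
    rw [IsHopfModule.coact_smul, hb, hm]
    simp [diagAct, rightAct]⟩
  one_smul m := Subtype.ext (one_smul Aᵐᵒᵖ (m : M))
  mul_smul a b m := Subtype.ext (mul_smul (op (a.unop).val) (op (b.unop).val) (m : M))
  smul_zero a := Subtype.ext (smul_zero (op (a.unop).val))
  smul_add a m n := Subtype.ext (smul_add (op (a.unop).val) (m : M) (n : M))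
  add_smul a b m := Subtype.ext (add_smul (op (a.unop).val) (op (b.unop).val) (m : M))
  zero_smul m := Subtype.ext (zero_smul Aᵐᵒᵖ (m : M))

instance : IsScalarTower k (coinvAlg k H A)ᵐᵒᵖ (coinv k H M) where
  smul_assoc c b m := Subtype.ext (smul_assoc c (op (b.unop).val) (m : M))

end CoinvModule

/-! ### Principal comodule algebras -/

section Principal

variable (k H A : Type*) [Field k] [Ring H] [HopfAlgebra k H]
  [Ring A] [Algebra k A] [RightComodule k H A] [IsComoduleAlgebra k H A]

/-- The relations `a b ⊗ a' = a ⊗ b a'`, `b ∈ B = A^{coH}`. -/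
def balancing : Submodule k (A ⊗[k] A) :=
  Submodule.span k {t | ∃ (a a' : A) (b : coinvAlg k H A),
    t = (a * b) ⊗ₜ[k] a' - a ⊗ₜ[k] ((b : A) * a')}

/-- The tensor product `A ⊗_B A` over the (in general noncommutative) algebra `B = A^{coH}`. -/
abbrev BalancedTensor : Type _ := (A ⊗[k] A) ⧸ balancing k H A

/-- `A ⊗ A → A ⊗ H`, `a ⊗ a' ↦ a ϱ(a')`. -/
noncomputable def canLift : A ⊗[k] A →ₗ[k] A ⊗[k] H :=
  TensorProduct.lift ((LinearMap.mul k (A ⊗[k] H)).compl₁₂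
    ((TensorProduct.mk k A H).flip 1) (coact k H))

/-- The canonical map `can : A ⊗_B A → A ⊗ H`, `a ⊗_B a' ↦ a ϱ(a')`. -/
noncomputable def can : BalancedTensor k H A →ₗ[k] A ⊗[k] H :=
  (balancing k H A).liftQ (canLift k H A) (by
    rw [balancing, Submodule.span_le]
    rintro _ ⟨a, a', b, rfl⟩
    have hb : coact k H (b : A) = (b : A) ⊗ₜ[k] (1 : H) := b.2
    simp only [canLift, SetLike.mem_coe, LinearMap.mem_ker, map_sub, TensorProduct.lift.tmul,
      LinearMap.compl₁₂_apply, LinearMap.flip_apply, TensorProduct.mk_apply, LinearMap.mul_apply',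
      IsComoduleAlgebra.coact_mul, hb, ← mul_assoc, Algebra.TensorProduct.tmul_mul_tmul, mul_one,
      sub_self])

/-- `B ⊆ A` is a Hopf-Galois extension: `can` is bijective. -/
def IsHopfGalois : Prop := Function.Bijective (can k H A)

/-- The multiplication `B ⊗ A → A`. -/
noncomputable def mulB : coinvAlg k H A ⊗[k] A →ₗ[k] A :=
  TensorProduct.lift ((LinearMap.mul k A).comp (coinvAlg k H A).val.toLinearMap)

/-- The coaction `id ⊗ ϱ` on `B ⊗ A`. -/
noncomputable def coactBA :
    coinvAlg k H A ⊗[k] A →ₗ[k] (coinvAlg k H A ⊗[k] A) ⊗[k] H :=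
  (TensorProduct.assoc k (coinvAlg k H A) A H).symm.toLinearMap ∘ₗ
    (coact k H).lTensor (coinvAlg k H A)

/-- `A` is an `H`-equivariantly projective left `B`-module: there is a left `B`-linear, right
`H`-colinear splitting `s : A → B ⊗ A` of the multiplication map `B ⊗ A → A`. -/
def IsEquivariantlyProjective : Prop :=
  ∃ s : A →ₗ[k] coinvAlg k H A ⊗[k] A,
    (∀ (b : coinvAlg k H A) (a : A), s ((b : A) * a) = b • s a) ∧
    (∀ a, coactBA k H A (s a) = s.rTensor H (coact k H a)) ∧
    ∀ a, mulB k H A (s a) = a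

/-- Principal comodule algebras. -/
structure IsPrincipal : Prop where
  antipode_bijective : Function.Bijective (HopfAlgebra.antipode k : H →ₗ[k] H)
  hopfGalois : IsHopfGalois k H A
  equivariantlyProjective : IsEquivariantlyProjective k H A

end Principal

/-! ### The universal first order differential calculus -/

section Universal

variable (k A : Type*) [Field k] [Ring A] [Algebra k A]

/-- The space `Ω¹_u(A) = ker (μ : A ⊗ A → A)`. -/
def UForms : Type _ := LinearMap.ker (LinearMap.mul' k A)

noncomputable instance : AddCommGroup (UForms k A) :=
  inferInstanceAs (AddCommGroup (LinearMap.ker (LinearMap.mul' k A)))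

noncomputable instance : Module k (UForms k A) :=
  inferInstanceAs (Module k (LinearMap.ker (LinearMap.mul' k A)))

/-- The inclusion `Ω¹_u(A) ⊆ A ⊗ A`. -/
noncomputable def UForms.incl : UForms k A →ₗ[k] A ⊗[k] A :=
  (LinearMap.ker (LinearMap.mul' k A)).subtype

theorem UForms.incl_injective : Function.Injective (UForms.incl k A) :=
  Subtype.val_injective

variable {k A}

@[ext] theorem UForms.ext {x y : UForms k A} (h : incl k A x = incl k A y) : x = y :=
  UForms.incl_injective k A h

theorem UForms.mul_incl (x : UForms k A) : LinearMap.mul' k A (incl k A x) = 0 := x.2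

theorem mul'_left (a : A) (x : A ⊗[k] A) :
    LinearMap.mul' k A ((a ⊗ₜ[k] (1 : A)) * x) = a * LinearMap.mul' k A x := by
  induction x with
  | zero => simp
  | tmul x y => simp [mul_assoc]
  | add x y hx hy => simp [mul_add, hx, hy]

theorem mul'_right (a : A) (x : A ⊗[k] A) :
    LinearMap.mul' k A (x * ((1 : A) ⊗ₜ[k] a)) = LinearMap.mul' k A x * a := by
  induction x with
  | zero => simp
  | tmul x y => simp [mul_assoc]
  | add x y hx hy => simp [add_mul, hx, hy]

/-- The left `A`-module structure `a (x ⊗ y) = a x ⊗ y`, written as the product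
`(a ⊗ 1) (x ⊗ y)` in the algebra `A ⊗ A`. -/
noncomputable instance : SMul A (UForms k A) where
  smul a x := ⟨(a ⊗ₜ[k] (1 : A)) * UForms.incl k A x, by
    rw [LinearMap.mem_ker, mul'_left, UForms.mul_incl, mul_zero]⟩

/-- The right `A`-module structure `(x ⊗ y) a = x ⊗ y a`, written as the product
`(x ⊗ y) (1 ⊗ a)` in the algebra `A ⊗ A`. -/
noncomputable instance : SMul Aᵐᵒᵖ (UForms k A) where
  smul a x := ⟨UForms.incl k A x * ((1 : A) ⊗ₜ[k] unop a), by
    rw [LinearMap.mem_ker, mul'_right, UForms.mul_incl, zero_mul]⟩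

theorem UForms.incl_smul (a : A) (x : UForms k A) :
    incl k A (a • x) = (a ⊗ₜ[k] (1 : A)) * incl k A x := rfl

theorem UForms.incl_op_smul (a : Aᵐᵒᵖ) (x : UForms k A) :
    incl k A (a • x) = incl k A x * ((1 : A) ⊗ₜ[k] unop a) := rfl

noncomputable instance : Module A (UForms k A) where
  one_smul x := by
    ext; rw [UForms.incl_smul, ← Algebra.TensorProduct.one_def, one_mul]
  mul_smul a b x := by
    ext; simp only [UForms.incl_smul, ← mul_assoc, Algebra.TensorProduct.tmul_mul_tmul, mul_one]
  smul_zero a := by ext; simp [UForms.incl_smul]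
  smul_add a x y := by ext; simp [UForms.incl_smul, mul_add]
  add_smul a b x := by ext; simp [UForms.incl_smul, TensorProduct.add_tmul, add_mul]
  zero_smul x := by ext; simp [UForms.incl_smul]

noncomputable instance : Module Aᵐᵒᵖ (UForms k A) where
  one_smul x := by
    ext; rw [UForms.incl_op_smul, unop_one, ← Algebra.TensorProduct.one_def, mul_one]
  mul_smul a b x := by
    ext; simp only [UForms.incl_op_smul, mul_assoc, Algebra.TensorProduct.tmul_mul_tmul, mul_one,
      unop_mul]
  smul_zero a := by ext; simp [UForms.incl_op_smul]
  smul_add a x y := by ext; simp [UForms.incl_op_smul, add_mul]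
  add_smul a b x := by ext; simp [UForms.incl_op_smul, TensorProduct.tmul_add, mul_add]
  zero_smul x := by ext; simp [UForms.incl_op_smul]

instance : SMulCommClass A Aᵐᵒᵖ (UForms k A) where
  smul_comm a b x := by ext; simp only [UForms.incl_smul, UForms.incl_op_smul, mul_assoc]

instance : IsScalarTower k Aᵐᵒᵖ (UForms k A) where
  smul_assoc c a x := by ext; simp [UForms.incl_op_smul]

instance : IsScalarTower k A (UForms k A) where
  smul_assoc c a x := by ext; simp [UForms.incl_smul, ← TensorProduct.smul_tmul']

variable (k A)

/-- The universal differential `d : A → Ω¹_u(A)`, `d a = 1 ⊗ a - a ⊗ 1`. -/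
noncomputable def univD : A →ₗ[k] UForms k A :=
  (TensorProduct.mk k A A 1 - (TensorProduct.mk k A A).flip 1).codRestrict
    (LinearMap.ker (LinearMap.mul' k A)) (fun a => by simp)

end Universal

/-! ### The coaction on the universal calculus -/

section Covariance

variable (k H A : Type*) [Field k] [Ring H] [HopfAlgebra k H]
  [Ring A] [Algebra k A] [RightComodule k H A]

/-- The pairing `(a ⊗ h, a' ⊗ h') ↦ a ⊗ a' ⊗ h h'`. -/
noncomputable def diagPair : A ⊗[k] H →ₗ[k] A ⊗[k] H →ₗ[k] (A ⊗[k] A) ⊗[k] H :=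
  TensorProduct.map₂ (TensorProduct.mk k A A) (LinearMap.mul k H)

/-- The diagonal coaction `a ⊗ a' ↦ a₍₀₎ ⊗ a'₍₀₎ ⊗ a₍₁₎ a'₍₁₎` on `A ⊗ A`. -/
noncomputable def diagCoact : A ⊗[k] A →ₗ[k] (A ⊗[k] A) ⊗[k] H :=
  TensorProduct.lift ((diagPair k H A).compl₁₂ (coact k H) (coact k H))

variable {k H A}

theorem diagCoact_tmul (a b : A) :
    diagCoact k H A (a ⊗ₜ b) = diagPair k H A (coact k H a) (coact k H b) := rfl

set_option linter.unusedSectionVars false in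
theorem diagPair_tmul (a b : A) (h g : H) :
    diagPair k H A (a ⊗ₜ h) (b ⊗ₜ g) = (a ⊗ₜ[k] b) ⊗ₜ[k] (h * g) := rfl

theorem bilin_ext {P : Type*} [AddCommGroup P] [Module k P] {V W X Y : Type*}
    [AddCommGroup V] [Module k V] [AddCommGroup W] [Module k W]
    [AddCommGroup X] [Module k X] [AddCommGroup Y] [Module k Y]
    {f g : V ⊗[k] W →ₗ[k] X ⊗[k] Y →ₗ[k] P}
    (h : ∀ v w x y, f (v ⊗ₜ w) (x ⊗ₜ y) = g (v ⊗ₜ w) (x ⊗ₜ y)) : f = g := by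
  ext v w x y
  exact h v w x y

theorem diagCoact_coassoc (t : A ⊗[k] A) :
    TensorProduct.assoc k (A ⊗[k] A) H H ((diagCoact k H A).rTensor H (diagCoact k H A t)) =
      (Coalgebra.comul (R := k) (A := H)).lTensor (A ⊗[k] A) (diagCoact k H A t) := by
  let F : A ⊗[k] (H ⊗[k] H) →ₗ[k] A ⊗[k] (H ⊗[k] H) →ₗ[k] (A ⊗[k] A) ⊗[k] (H ⊗[k] H) :=
    TensorProduct.map₂ (TensorProduct.mk k A A) (LinearMap.mul k (H ⊗[k] H))
  have key (h g : H) (p q : A ⊗[k] H) :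
      TensorProduct.assoc k (A ⊗[k] A) H H (diagPair k H A p q ⊗ₜ (h * g)) =
        F (TensorProduct.assoc k A H H (p ⊗ₜ h)) (TensorProduct.assoc k A H H (q ⊗ₜ g)) := by
    induction p with
    | zero => simp
    | add p p' hp hp' => simp only [map_add, LinearMap.add_apply, TensorProduct.add_tmul, hp, hp']
    | tmul a x =>
      induction q with
      | zero => simp
      | add q q' hq hq' => simp only [map_add, TensorProduct.add_tmul, hq, hq']
      | tmul b y => simp [diagPair_tmul, F]
  have h1 : ((diagPair k H A).compr₂ ((TensorProduct.assoc k (A ⊗[k] A) H H).toLinearMap ∘ₗ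
      (diagCoact k H A).rTensor H)) =
      F.compl₁₂ ((TensorProduct.assoc k A H H).toLinearMap ∘ₗ (coact k H).rTensor H)
        ((TensorProduct.assoc k A H H).toLinearMap ∘ₗ (coact k H).rTensor H) := by
    refine bilin_ext fun a h b g => ?_
    exact key h g (coact k H a) (coact k H b)
  have h2 : ((diagPair k H A).compr₂ ((Coalgebra.comul (R := k) (A := H)).lTensor (A ⊗[k] A))) =
      F.compl₁₂ ((Coalgebra.comul (R := k) (A := H)).lTensor A)
        ((Coalgebra.comul (R := k) (A := H)).lTensor A) := by
    refine bilin_ext fun a h b g => ?_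
    simp [diagPair_tmul, F, Bialgebra.comul_mul]
  induction t with
  | zero => simp
  | add x y hx hy => simp only [map_add, hx, hy]
  | tmul a b =>
    have e1 := LinearMap.congr_fun (LinearMap.congr_fun h1 (coact k H a)) (coact k H b)
    have e2 := LinearMap.congr_fun (LinearMap.congr_fun h2 (coact k H a)) (coact k H b)
    simp only [LinearMap.compr₂_apply, LinearMap.compl₁₂_apply, LinearMap.comp_apply,
      LinearEquiv.coe_coe] at e1 e2
    rw [diagCoact_tmul, e1, e2, RightComodule.coassoc, RightComodule.coassoc]

theorem diagCoact_counit (t : A ⊗[k] A) :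
    TensorProduct.rid k (A ⊗[k] A)
      ((Coalgebra.counit (R := k) (A := H)).lTensor (A ⊗[k] A) (diagCoact k H A t)) = t := by
  have h1 : (diagPair k H A).compr₂ ((TensorProduct.rid k (A ⊗[k] A)).toLinearMap ∘ₗ
      (Coalgebra.counit (R := k) (A := H)).lTensor (A ⊗[k] A)) =
      (TensorProduct.mk k A A).compl₁₂
        ((TensorProduct.rid k A).toLinearMap ∘ₗ (Coalgebra.counit (R := k) (A := H)).lTensor A)
        ((TensorProduct.rid k A).toLinearMap ∘ₗ
          (Coalgebra.counit (R := k) (A := H)).lTensor A) := by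
    refine bilin_ext fun a h b g => ?_
    simp [diagPair_tmul, Bialgebra.counit_mul, TensorProduct.smul_tmul',
      smul_smul, mul_comm]
  induction t with
  | zero => simp
  | add x y hx hy => simp only [map_add, hx, hy]
  | tmul a b =>
    have e1 := LinearMap.congr_fun (LinearMap.congr_fun h1 (coact k H a)) (coact k H b)
    simp only [LinearMap.compr₂_apply, LinearMap.compl₁₂_apply, LinearMap.comp_apply,
      LinearEquiv.coe_coe, TensorProduct.mk_apply] at e1
    rw [diagCoact_tmul, e1, RightComodule.counit_coact, RightComodule.counit_coact]

variable [IsComoduleAlgebra k H A]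

theorem mul_diagCoact (t : A ⊗[k] A) :
    (LinearMap.mul' k A).rTensor H (diagCoact k H A t) = coact k H (LinearMap.mul' k A t) := by
  have h1 : (diagPair k H A).compr₂ ((LinearMap.mul' k A).rTensor H) =
      LinearMap.mul k (A ⊗[k] H) := by
    refine bilin_ext fun a h b g => ?_
    simp [diagPair_tmul]
  induction t with
  | zero => simp
  | add x y hx hy => simp only [map_add, hx, hy]
  | tmul a b =>
    have e1 := LinearMap.congr_fun (LinearMap.congr_fun h1 (coact k H a)) (coact k H b)
    rw [LinearMap.compr₂_apply] at e1
    rw [diagCoact_tmul, e1, LinearMap.mul'_apply, IsComoduleAlgebra.coact_mul]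
    rfl

theorem diagCoact_mem (x : UForms k A) :
    diagCoact k H A (UForms.incl k A x) ∈ LinearMap.range ((UForms.incl k A).rTensor H) := by
  have hex : Function.Exact (UForms.incl k A) (LinearMap.mul' k A) :=
    LinearMap.exact_subtype_ker_map _
  have := Module.Flat.rTensor_exact H hex
  exact (this _).1 (by rw [mul_diagCoact, UForms.mul_incl, map_zero])

/-- The coaction on `Ω¹_u(A)` is the restriction of the diagonal coaction on `A ⊗ A`. -/
noncomputable instance : RightComodule k H (UForms k A) :=
  RightComodule.ofInjective (diagCoact k H A) diagCoact_coassoc diagCoact_counit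
    (UForms.incl k A) (UForms.incl_injective k A) diagCoact_mem

theorem UForms.incl_coact (x : UForms k A) :
    (UForms.incl k A).rTensor H (coact k H x) = diagCoact k H A (UForms.incl k A x) :=
  rTensor_restrictCoact _ _ _ _ x

instance : IsHopfModule k H A (UForms k A) where
  coact_smul x a := by
    apply Module.Flat.rTensor_preserves_injective_linearMap (M := H) _ (UForms.incl_injective k A)
    let G : (A ⊗[k] A) ⊗[k] H →ₗ[k] A ⊗[k] H →ₗ[k] (A ⊗[k] A) ⊗[k] H :=
      TensorProduct.map₂ ((LinearMap.mul k (A ⊗[k] A)).compl₁₂ LinearMap.id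
        (TensorProduct.mk k A A 1)) (LinearMap.mul k H)
    have h1 : (diagAct k H A (UForms k A)).compr₂ ((UForms.incl k A).rTensor H) =
        G.compl₁₂ ((UForms.incl k A).rTensor H) LinearMap.id := by
      refine bilin_ext fun x h b g => ?_
      simp [diagAct, G, rightAct, UForms.incl_op_smul]
    have h2 (p q r : A ⊗[k] H) : diagPair k H A p (q * r) = G (diagPair k H A p q) r := by
      induction p with
      | zero => simp
      | add p p' hp hp' => simp only [map_add, LinearMap.add_apply, hp, hp']
      | tmul a x =>
        induction q with
        | zero => simp
        | add q q' hq hq' => simp only [map_add, LinearMap.add_apply, add_mul, hq, hq']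
        | tmul b y =>
          induction r with
          | zero => simp
          | add r r' hr hr' => simp only [map_add, mul_add, hr, hr']
          | tmul c z => simp [diagPair_tmul, G, mul_assoc]
    have h3 (t : A ⊗[k] A) : diagCoact k H A (t * ((1 : A) ⊗ₜ[k] a)) =
        G (diagCoact k H A t) (coact k H a) := by
      induction t with
      | zero => simp
      | add t t' ht ht' => simp only [map_add, LinearMap.add_apply, add_mul, ht, ht']
      | tmul u v =>
        rw [Algebra.TensorProduct.tmul_mul_tmul, mul_one, diagCoact_tmul, diagCoact_tmul,
          IsComoduleAlgebra.coact_mul, h2]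
    have e1 := LinearMap.congr_fun (LinearMap.congr_fun h1 (coact k H x)) (coact k H a)
    simp only [LinearMap.compr₂_apply, LinearMap.compl₁₂_apply, LinearMap.id_apply] at e1
    rw [e1, UForms.incl_coact, UForms.incl_coact, UForms.incl_op_smul, unop_op, h3]

end Covariance

/-! ### The module `Ω¹_u(B) A` -/

section Horizontal

variable (k H A : Type*) [Field k] [Ring H] [HopfAlgebra k H]
  [Ring A] [Algebra k A] [RightComodule k H A] [IsComoduleAlgebra k H A]

/-- The map `Ω¹_u(B) → Ω¹_u(A)` induced by the inclusion `B ⊗ B → A ⊗ A`. -/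
noncomputable def formsOfBase : UForms k (coinvAlg k H A) →ₗ[k] UForms k A :=
  (TensorProduct.map (coinvAlg k H A).val.toLinearMap (coinvAlg k H A).val.toLinearMap ∘ₗ
    UForms.incl k (coinvAlg k H A)).codRestrict (LinearMap.ker (LinearMap.mul' k A)) (by
      intro x
      have h : LinearMap.mul' k A ∘ₗ TensorProduct.map (coinvAlg k H A).val.toLinearMap
          (coinvAlg k H A).val.toLinearMap =
          (coinvAlg k H A).val.toLinearMap ∘ₗ LinearMap.mul' k (coinvAlg k H A) := by
        ext; simp
      have := LinearMap.congr_fun h (UForms.incl k _ x)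
      simp only [LinearMap.comp_apply, UForms.mul_incl, map_zero] at this
      exact this)

/-- The right `A`-submodule `Ω¹_u(B) A` of `Ω¹_u(A)`. -/
noncomputable def horizontal : Submodule Aᵐᵒᵖ (UForms k A) :=
  Submodule.span Aᵐᵒᵖ (Set.range (formsOfBase k H A))

/-- `Ω¹_u(B) A` as a type. -/
abbrev HForms : Type _ := horizontal k H A

/-- The map `Ω¹_u(B) → Ω¹_u(B) A`. -/
noncomputable def baseToHorizontal : UForms k (coinvAlg k H A) →ₗ[k] HForms k H A :=
  (formsOfBase k H A).codRestrict ((horizontal k H A).restrictScalars k)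
    (fun x => Submodule.subset_span ⟨x, rfl⟩)

variable {k H A}

theorem formsOfBase_smul (b : coinvAlg k H A) (x : UForms k (coinvAlg k H A)) :
    formsOfBase k H A (b • x) = (b : A) • formsOfBase k H A x := by
  apply UForms.ext
  change TensorProduct.map (coinvAlg k H A).val.toLinearMap (coinvAlg k H A).val.toLinearMap
      ((b ⊗ₜ[k] 1) * UForms.incl k _ x) = ((b : A) ⊗ₜ[k] (1 : A)) *
    TensorProduct.map (coinvAlg k H A).val.toLinearMap (coinvAlg k H A).val.toLinearMap
      (UForms.incl k _ x)
  induction UForms.incl k _ x with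
  | zero => simp
  | add x y hx hy => simp only [map_add, mul_add, hx, hy]
  | tmul x y => simp

theorem smul_mem_horizontal (b : coinvAlg k H A) {x : UForms k A} (hx : x ∈ horizontal k H A) :
    (b : A) • x ∈ horizontal k H A := by
  induction hx using Submodule.span_induction with
  | mem x hx =>
    obtain ⟨y, rfl⟩ := hx
    exact Submodule.subset_span ⟨b • y, formsOfBase_smul b y⟩
  | zero => rw [smul_zero]; exact zero_mem _
  | add x y _ _ hx hy => rw [smul_add]; exact add_mem hx hy
  | smul a x _ hx => rw [smul_comm]; exact Submodule.smul_mem _ _ hx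

/-- The left `B`-module structure of `Ω¹_u(B) A`, restricted from `Ω¹_u(A)`. -/
noncomputable instance : Module (coinvAlg k H A) (HForms k H A) where
  smul b x := ⟨(b : A) • (x : UForms k A), smul_mem_horizontal b x.2⟩
  one_smul x := Subtype.ext (one_smul A (x : UForms k A))
  mul_smul a b x := Subtype.ext (mul_smul (a : A) (b : A) (x : UForms k A))
  smul_zero a := Subtype.ext (smul_zero (a : A))
  smul_add a x y := Subtype.ext (smul_add (a : A) (x : UForms k A) (y : UForms k A))
  add_smul a b x := Subtype.ext (add_smul (a : A) (b : A) (x : UForms k A))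
  zero_smul x := Subtype.ext (zero_smul A (x : UForms k A))

instance : IsScalarTower k (coinvAlg k H A) (HForms k H A) where
  smul_assoc c b x := Subtype.ext (smul_assoc c (b : A) (x : UForms k A))

instance : SMulCommClass (coinvAlg k H A) Aᵐᵒᵖ (HForms k H A) where
  smul_comm b a x := Subtype.ext (smul_comm (b : A) a (x : UForms k A))

theorem coact_mem_horizontal (x : HForms k H A) :
    coact k H (x : UForms k A) ∈
      LinearMap.range (((horizontal k H A).subtype.restrictScalars k).rTensor H) := by
  obtain ⟨x, hx⟩ := x
  change coact k H x ∈ _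
  induction hx using Submodule.span_induction with
  | mem x hx =>
    obtain ⟨y, rfl⟩ := hx
    refine ⟨baseToHorizontal k H A y ⊗ₜ 1, ?_⟩
    apply Module.Flat.rTensor_preserves_injective_linearMap (M := H) _ (UForms.incl_injective k A)
    rw [UForms.incl_coact]
    change UForms.incl k A (formsOfBase k H A y) ⊗ₜ[k] (1 : H) = _
    change TensorProduct.map (coinvAlg k H A).val.toLinearMap (coinvAlg k H A).val.toLinearMap
      (UForms.incl k _ y) ⊗ₜ[k] (1 : H) = diagCoact k H A
      (TensorProduct.map (coinvAlg k H A).val.toLinearMap (coinvAlg k H A).val.toLinearMap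
      (UForms.incl k _ y))
    induction UForms.incl k _ y with
    | zero => simp
    | add x y hx hy => simp only [map_add, TensorProduct.add_tmul, hx, hy]
    | tmul a b =>
      have ha : coact k H (a : A) = (a : A) ⊗ₜ[k] (1 : H) := a.2
      have hb : coact k H (b : A) = (b : A) ⊗ₜ[k] (1 : H) := b.2
      simp [diagCoact_tmul, ha, hb, diagPair_tmul]
  | zero => rw [map_zero]; exact zero_mem _
  | add x y _ _ hx hy => rw [map_add]; exact add_mem hx hy
  | smul a x _ hx =>
    obtain ⟨t, ht⟩ := hx
    refine ⟨diagAct k H A (HForms k H A) t (coact k H a.unop), ?_⟩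
    have h1 : (diagAct k H A (HForms k H A)).compr₂
        (((horizontal k H A).subtype.restrictScalars k).rTensor H) =
        (diagAct k H A (UForms k A)).compl₁₂
          (((horizontal k H A).subtype.restrictScalars k).rTensor H) LinearMap.id := by
      refine bilin_ext fun x h b g => ?_
      simp [diagAct, rightAct]
    have e1 := LinearMap.congr_fun (LinearMap.congr_fun h1 t) (coact k H a.unop)
    simp only [LinearMap.compr₂_apply, LinearMap.compl₁₂_apply, LinearMap.id_apply] at e1
    rw [e1, ht, ← IsHopfModule.coact_smul, op_unop]

/-- The coaction on `Ω¹_u(B) A` is the restriction of the coaction on `Ω¹_u(A)`. -/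
noncomputable instance : RightComodule k H (HForms k H A) :=
  RightComodule.ofInjective (coact k H) RightComodule.coassoc RightComodule.counit_coact
    ((horizontal k H A).subtype.restrictScalars k) Subtype.val_injective coact_mem_horizontal

end Horizontal

/-! ### The category `_B M_A^H` -/

section RelativeBimodules

variable (k H A : Type*) [Field k] [Ring H] [HopfAlgebra k H]
  [Ring A] [Algebra k A] [RightComodule k H A] [IsComoduleAlgebra k H A]

/-- Objects of `_B M_A^H`: `(A, H)`-Hopf modules with a left action of `B` by right `A`-linear and
right `H`-colinear maps. -/
structure IsRelativeBimodule (X : Type*) [AddCommGroup X] [Module k X]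
    [Module (coinvAlg k H A) X] [IsScalarTower k (coinvAlg k H A) X]
    [Module Aᵐᵒᵖ X] [IsScalarTower k Aᵐᵒᵖ X] [SMulCommClass (coinvAlg k H A) Aᵐᵒᵖ X]
    [RightComodule k H X] : Prop where
  hopf : IsHopfModule k H A X
  colinear : ∀ b : coinvAlg k H A, IsColinear k H (DistribSMul.toLinearMap k X b)

variable {A}

/-- Morphisms of `_B M_A^H`: left `B`-linear, right `A`-linear, right `H`-colinear maps. -/
structure IsRelativeBimoduleHom {X Y : Type*}
    [AddCommGroup X] [Module k X] [Module (coinvAlg k H A) X] [Module Aᵐᵒᵖ X]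
    [IsScalarTower k Aᵐᵒᵖ X] [RightComodule k H X]
    [AddCommGroup Y] [Module k Y] [Module (coinvAlg k H A) Y] [Module Aᵐᵒᵖ Y]
    [IsScalarTower k Aᵐᵒᵖ Y] [RightComodule k H Y] (f : X →ₗ[Aᵐᵒᵖ] Y) : Prop where
  map_smul : ∀ (b : coinvAlg k H A) (x : X), f (b • x) = b • f x
  colinear : IsColinear k H (f.restrictScalars k)

/-- `Π : Ω¹_u(A) → Ω¹_u(B) A` is a morphism of `_B M_A^H` that splits the inclusion
`Ω¹_u(B) A ⊆ Ω¹_u(A)`. -/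
structure IsHorizontalRetraction (p : UForms k A →ₗ[Aᵐᵒᵖ] HForms k H A) : Prop where
  hom : IsRelativeBimoduleHom k H p
  retract : ∀ x : HForms k H A, p (x : UForms k A) = x

end RelativeBimodules

/-! ### Hom-connections -/

section HomConnection

variable {k A Ω M : Type*} [Field k] [Ring A] [Algebra k A]
  [AddCommGroup Ω] [Module k Ω] [Module A Ω] [Module Aᵐᵒᵖ Ω] [SMulCommClass A Aᵐᵒᵖ Ω]
  [AddCommGroup M] [Module k M] [Module Aᵐᵒᵖ M] [IsScalarTower k Aᵐᵒᵖ M]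

/-- The right `A`-action `(f a)(ω) = f (a ω)` on right `A`-linear maps `Ω → M`. -/
def homAct (f : Ω →ₗ[Aᵐᵒᵖ] M) (a : A) : Ω →ₗ[Aᵐᵒᵖ] M :=
  f ∘ₗ DistribSMul.toLinearMap Aᵐᵒᵖ Ω a

/-- A `k`-linear map `∇ : Hom_A(Ω, M) → M` is a right hom-connection on `M` with respect to a
differential graded algebra over `A` whose degree one part is `Ω` and whose differential in degree
zero is `d : A → Ω`: `∇ (f a) = ∇ (f) a + f (d a)`. (The definition involves no other part of the
differential graded algebra.) -/
def IsHomConnection (d : A →ₗ[k] Ω) (nabla : (Ω →ₗ[Aᵐᵒᵖ] M) →ₗ[k] M) : Prop :=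
  ∀ (f : Ω →ₗ[Aᵐᵒᵖ] M) (a : A), nabla (homAct f a) = op a • nabla f + f (d a)

end HomConnection

section Descent

variable (k H A : Type*) [Field k] [Ring H] [HopfAlgebra k H]
  [Ring A] [Algebra k A] [RightComodule k H A] [IsComoduleAlgebra k H A]
  {M : Type*} [AddCommGroup M] [Module k M] [Module Aᵐᵒᵖ M] [IsScalarTower k Aᵐᵒᵖ M]
  [RightComodule k H M] [IsHopfModule k H A M]

/-- `g : Ω¹_u(B) A → M` is a morphism of `M_A^H` that extends `f : Ω¹_u(B) → M^{coH}`. -/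
structure IsHopfExtension (f : UForms k (coinvAlg k H A) →ₗ[(coinvAlg k H A)ᵐᵒᵖ] coinv k H M)
    (g : HForms k H A →ₗ[Aᵐᵒᵖ] M) : Prop where
  colinear : IsColinear k H (g.restrictScalars k)
  extends_base : ∀ ω, g (baseToHorizontal k H A ω) = f ω

end Descent

end HopfGalois

/-! Write `ϱ(a) = a₀ ⊗ a₁`. If the splitting `s : A → B ⊗ A` is unital, then `s b = b s(1) = b ⊗ 1`
for `b ∈ B`, and `Π(Σ aᵢ ⊗ aᵢ') = Σ s(aᵢ) aᵢ'` does everything: `s` splits the multiplication, so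
`Π` sends `Ω¹_u(A)` into `ker (B ⊗ A → A) = Ω¹_u(B) A`, it fixes `d(b) a`, and linearity and
colinearity are inherited from `s`.

A given `s` need not be unital, and principality repairs this. Choose a linear projection `q : A →
B`. The Galois condition and `s` give a total integral `j : H → A`, the composite of `h ↦ can⁻¹(1 ⊗
h)` with `a ⊗ a' ↦ q(a a'⁰) a'¹`, where `s a' = a'⁰ ⊗ a'¹` (`IsPrincipal.exists_totalIntegral`). It
yields the left `B`-linear unital map `E(a) = a₀ j(S a₁)` from `A` to `B`
(`coactConv_antipode_mem`). With `e = s(1) - 1 ⊗ 1`, the map `a ↦ s(a) - E(a₀) e j(a₁)` is a unital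
splitting with the same equivariance (`IsPrincipal.exists_unital_splitting`).

For the descent, `Ω¹_u(B) A` is generated over `A` by coinvariant forms, so extensions are unique
and colinear, and `f̂(Σ bᵢ ⊗ aᵢ) = -Σ f(d bᵢ) aᵢ` provides one. Left `B`-linearity of `Π` gives `(f
b)^ ∘ Π = (f̂ ∘ Π) b`, and `Π(d b) = d b`; the Leibniz rule for `∇` therefore restricts to that for
`∇^{coH}`. -/

namespace HopfGalois

/-! ### Convolution on a comodule -/

section ConvolutionAction

variable {k H A C : Type*} [Field k] [Ring H] [HopfAlgebra k H]
  [AddCommGroup A] [Module k A] [RightComodule k H A] [Ring C] [Algebra k C]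

/-- The convolution action `(f ⋆ u) a = f a₍₀₎ * u a₍₁₎` of `Hom(H, C)` on `Hom(A, C)`. -/
noncomputable def coactConv (f : A →ₗ[k] C) (u : H →ₗ[k] C) : A →ₗ[k] C :=
  LinearMap.mul' k C ∘ₗ TensorProduct.map f u ∘ₗ coact k H

/-- This is coassociativity of the coaction combined with associativity of `C`. It moves
computations on the `H`-legs into the convolution algebra `Hom(H, C)`. -/
theorem coactConv_coactConv (f : A →ₗ[k] C) (u v : H →ₗ[k] C) :
    coactConv (coactConv f u) v =
      coactConv f (WithConv.toConv u * WithConv.toConv v : WithConv (H →ₗ[k] C)).ofConv := by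
  have h1 : LinearMap.mul' k C ∘ₗ TensorProduct.map (coactConv f u) v =
      (LinearMap.mul' k C ∘ₗ TensorProduct.map f (LinearMap.mul' k C ∘ₗ TensorProduct.map u v)) ∘ₗ
        (TensorProduct.assoc k A H H).toLinearMap ∘ₗ (coact k H).rTensor H := by
    ext a h
    have h2 : ∀ t : A ⊗[k] H,
        LinearMap.mul' k C (TensorProduct.map f u t) * v h =
          LinearMap.mul' k C (TensorProduct.map f (LinearMap.mul' k C ∘ₗ TensorProduct.map u v)
            (TensorProduct.assoc k A H H (t ⊗ₜ h))) := by
      intro t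
      induction t with
      | zero => simp
      | add x y hx hy => simp only [map_add, add_mul, TensorProduct.add_tmul, hx, hy]
      | tmul x y => simp [mul_assoc]
    simpa [coactConv] using h2 (coact k H a)
  ext a
  change (LinearMap.mul' k C ∘ₗ TensorProduct.map (coactConv f u) v) (coact k H a) = _
  rw [h1]
  simp only [LinearMap.comp_apply, LinearEquiv.coe_coe, RightComodule.coassoc]
  simp only [coactConv, LinearMap.comp_apply, LinearMap.convMul_def, WithConv.ofConv_toConv]
  rw [← LinearMap.comp_apply (TensorProduct.map f _), LinearMap.map_comp_lTensor]
  rfl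

end ConvolutionAction

/-! ### Total integrals and coinvariant elements -/

section ComoduleAlgebra

variable {k H A : Type*} [Field k] [Ring H] [HopfAlgebra k H]
  [Ring A] [Algebra k A] [RightComodule k H A]

/-- Since `a₀ ⊗ a₁ = (a₀ ⊗ 1)(1 ⊗ a₁)`, the coaction is itself a convolution, and
`coactConv_coactConv` applies to products such as `ϱ(a₀) ϱ(u a₁)`. -/
theorem coactConv_includeLeft_includeRight :
    coactConv (Algebra.TensorProduct.includeLeft : A →ₐ[k] A ⊗[k] H).toLinearMap
      (Algebra.TensorProduct.includeRight : H →ₐ[k] A ⊗[k] H).toLinearMap = coact k H := by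
  have h : LinearMap.mul' k (A ⊗[k] H) ∘ₗ TensorProduct.map
      (Algebra.TensorProduct.includeLeft : A →ₐ[k] A ⊗[k] H).toLinearMap
      (Algebra.TensorProduct.includeRight : H →ₐ[k] A ⊗[k] H).toLinearMap = LinearMap.id := by
    ext a h
    simp
  rw [coactConv, ← LinearMap.comp_assoc, h, LinearMap.id_comp]

variable [IsComoduleAlgebra k H A]

theorem coact_coactConv (f : A →ₗ[k] A) (u : H →ₗ[k] A) :
    coact k H ∘ₗ coactConv f u = coactConv (coact k H ∘ₗ f) (coact k H ∘ₗ u) := by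
  have h : coact k H ∘ₗ LinearMap.mul' k A =
      LinearMap.mul' k (A ⊗[k] H) ∘ₗ TensorProduct.map (coact k H) (coact k H) := by
    ext a b
    simp [IsComoduleAlgebra.coact_mul]
  rw [coactConv, ← LinearMap.comp_assoc, h, coactConv, TensorProduct.map_comp]
  simp only [LinearMap.comp_assoc]

variable (k H) in
/-- `h₍₁₎`-twisted comultiplicativity of the antipode: `(1 ⊗ h₍₁₎) Δ(S h₍₂₎) = S h ⊗ 1`. -/
theorem includeRight_convMul_comul_antipode :
    (WithConv.toConv (Algebra.TensorProduct.includeRight : H →ₐ[k] H ⊗[k] H).toLinearMap *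
      WithConv.toConv (Coalgebra.comul ∘ₗ HopfAlgebra.antipode k) :
        WithConv (H →ₗ[k] H ⊗[k] H)) =
      WithConv.toConv ((Algebra.TensorProduct.includeLeft : H →ₐ[k] H ⊗[k] H).toLinearMap ∘ₗ
        HopfAlgebra.antipode k) := by
  set iL := (Algebra.TensorProduct.includeLeft : H →ₐ[k] H ⊗[k] H).toLinearMap
  set iR := (Algebra.TensorProduct.includeRight : H →ₐ[k] H ⊗[k] H).toLinearMap
  -- An algebra map composed with `S` is a left convolution inverse of that map.
  have h1 : (WithConv.toConv (iL ∘ₗ HopfAlgebra.antipode k) * WithConv.toConv iL :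
      WithConv (H →ₗ[k] H ⊗[k] H)) = 1 := by
    have := LinearMap.algHom_comp_convMul_distrib
      (Algebra.TensorProduct.includeLeft : H →ₐ[k] H ⊗[k] H)
      (WithConv.toConv (HopfAlgebra.antipode k)) (WithConv.toConv (LinearMap.id (R := k) (M := H)))
    rw [LinearMap.antipode_mul_id] at this
    apply WithConv.ofConv_injective
    refine Eq.trans this.symm ?_
    ext h
    simp [LinearMap.convOne_def]
  -- `Δ h = (h₁ ⊗ 1)(1 ⊗ h₂)`. As `Δ ∘ S` is a right inverse of `Δ = iL * iR`, cancelling `iL` on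
  -- the left leaves `iR * (Δ ∘ S) = iL ∘ S`.
  have h2 : (WithConv.toConv iL * WithConv.toConv iR : WithConv (H →ₗ[k] H ⊗[k] H)) =
      WithConv.toConv Coalgebra.comul := by
    have : LinearMap.mul' k (H ⊗[k] H) ∘ₗ TensorProduct.map iL iR = LinearMap.id := by
      ext a h
      simp [iL, iR]
    rw [LinearMap.convMul_def, ← LinearMap.comp_assoc]
    simp only [this, LinearMap.id_comp]
  have h3 := LinearMap.comul_right_inv (R := k) (C := H)
  rw [← h2] at h3
  calc _ = (WithConv.toConv (iL ∘ₗ HopfAlgebra.antipode k) * WithConv.toConv iL) *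
        (WithConv.toConv iR * WithConv.toConv (Coalgebra.comul ∘ₗ HopfAlgebra.antipode k)) := by
        rw [h1, one_mul]
    _ = _ := by rw [mul_assoc, ← mul_assoc (WithConv.toConv iL), h3, mul_one]

/-- A total integral `j` gives the coinvariant elements `a₍₀₎ j(S a₍₁₎)`. -/
theorem coactConv_antipode_mem (j : H →ₗ[k] A)
    (hj : ∀ h, coact k H (j h) = j.rTensor H (Coalgebra.comul h)) (a : A) :
    coactConv LinearMap.id (j ∘ₗ HopfAlgebra.antipode k) a ∈ coinvAlg k H A := by
  change coact k H _ = _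
  -- `(1 ⊗ h₁) ϱ(j(S h₂)) = j(S h) ⊗ 1`: colinearity of `j` makes this the image under `j ⊗ id` of
  -- the antipode identity in `H ⊗ H`.
  have h1 : (WithConv.toConv (Algebra.TensorProduct.includeRight : H →ₐ[k] A ⊗[k] H).toLinearMap *
      WithConv.toConv (coact k H ∘ₗ j ∘ₗ HopfAlgebra.antipode k) :
        WithConv (H →ₗ[k] A ⊗[k] H)).ofConv =
      (Algebra.TensorProduct.includeLeft : A →ₐ[k] A ⊗[k] H).toLinearMap ∘ₗ j ∘ₗ
        HopfAlgebra.antipode k := by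
    have h2 : LinearMap.mul' k (A ⊗[k] H) ∘ₗ TensorProduct.map
        (Algebra.TensorProduct.includeRight : H →ₐ[k] A ⊗[k] H).toLinearMap (j.rTensor H) =
        j.rTensor H ∘ₗ LinearMap.mul' k (H ⊗[k] H) ∘ₗ TensorProduct.map
        (Algebra.TensorProduct.includeRight : H →ₐ[k] H ⊗[k] H).toLinearMap LinearMap.id := by
      ext a b c
      simp
    have h3 : coact k H ∘ₗ j = j.rTensor H ∘ₗ Coalgebra.comul := LinearMap.ext hj
    have h4 := congrArg WithConv.ofConv (includeRight_convMul_comul_antipode k H)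
    rw [LinearMap.convMul_def] at h4 ⊢
    dsimp only at h4 ⊢
    rw [← LinearMap.comp_assoc _ j, h3]
    have h5 : ∀ (x : H →ₗ[k] A ⊗[k] H) (y : H →ₗ[k] H ⊗[k] H),
        TensorProduct.map x (j.rTensor H ∘ₗ y) =
          TensorProduct.map x (j.rTensor H) ∘ₗ TensorProduct.map LinearMap.id y := by
      intro x y
      rw [← TensorProduct.map_comp, LinearMap.comp_id]
    rw [LinearMap.comp_assoc, h5, LinearMap.comp_assoc, ← LinearMap.comp_assoc, h2]
    have h6 : ∀ (x y : H →ₗ[k] H ⊗[k] H),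
        TensorProduct.map x y =
          TensorProduct.map x LinearMap.id ∘ₗ TensorProduct.map LinearMap.id y := by
      intro x y
      rw [← TensorProduct.map_comp, LinearMap.comp_id, LinearMap.id_comp]
    rw [h6] at h4
    simp only [LinearMap.comp_assoc] at h4 ⊢
    rw [h4]
    ext h
    simp
  -- `ϱ(a₀ j(S a₁)) = ϱ(a₀) ϱ(j(S a₁))`; splitting the first factor as `(a₀ ⊗ 1)(1 ⊗ a₁)` and
  -- reassociating brings `h1` into play and leaves `a₀ j(S a₁) ⊗ 1`.
  have h7 := coact_coactConv (k := k) (H := H) LinearMap.id (j ∘ₗ HopfAlgebra.antipode k) (A := A)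
  rw [LinearMap.comp_id] at h7
  nth_rewrite 2 [← coactConv_includeLeft_includeRight] at h7
  rw [coactConv_coactConv, h1] at h7
  refine (LinearMap.congr_fun h7 a).trans ?_
  have h8 : ∀ t : A ⊗[k] H, LinearMap.mul' k (A ⊗[k] H) (TensorProduct.map
      (Algebra.TensorProduct.includeLeft : A →ₐ[k] A ⊗[k] H).toLinearMap
      ((Algebra.TensorProduct.includeLeft : A →ₐ[k] A ⊗[k] H).toLinearMap ∘ₗ j ∘ₗ
        HopfAlgebra.antipode k) t) = LinearMap.mul' k A (TensorProduct.map LinearMap.id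
          (j ∘ₗ HopfAlgebra.antipode k) t) ⊗ₜ[k] (1 : H) := by
    intro t
    induction t with
    | zero => simp
    | add x y hx hy => simp only [map_add, TensorProduct.add_tmul, hx, hy]
    | tmul x y => simp
  exact h8 _

theorem coact_coinv_mul (b : coinvAlg k H A) (a : A) :
    coact k H ((b : A) * a) = ((b : A) ⊗ₜ[k] (1 : H)) * coact k H a := by
  have hb : coact k H (b : A) = (b : A) ⊗ₜ[k] (1 : H) := b.2
  rw [IsComoduleAlgebra.coact_mul, hb]

theorem coactConv_id_coinv_mul (u : H →ₗ[k] A) (b : coinvAlg k H A) (a : A) :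
    coactConv LinearMap.id u ((b : A) * a) = b * coactConv LinearMap.id u a := by
  simp only [coactConv, LinearMap.comp_apply, coact_coinv_mul]
  induction coact k H a with
  | zero => simp
  | add x y hx hy => simp only [map_add, mul_add, hx, hy]
  | tmul x y => simp [mul_assoc]

/-- A linear projection of `A` onto the coinvariants. -/
theorem exists_coinv_projection : ∃ q : A →ₗ[k] coinvAlg k H A, ∀ b : coinvAlg k H A, q b = b := by
  -- A vector space complement suffices; no compatibility with products or coactions is claimed for
  -- `q`.
  obtain ⟨q, hq⟩ := LinearMap.exists_leftInverse_of_injective (coinvAlg k H A).val.toLinearMap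
    (LinearMap.ker_eq_bot.2 Subtype.val_injective)
  exact ⟨q, LinearMap.congr_fun hq⟩

/-- Principal comodule algebras admit a total integral. -/
theorem IsPrincipal.exists_totalIntegral (hA : IsPrincipal k H A) :
    ∃ j : H →ₗ[k] A, j 1 = 1 ∧ ∀ h, coact k H (j h) = j.rTensor H (Coalgebra.comul h) := by
  obtain ⟨s, hs1, hs2, hs3⟩ := hA.equivariantlyProjective
  obtain ⟨q, hq⟩ := exists_coinv_projection (k := k) (H := H) (A := A)
  -- `G (a ⊗ a') = q(a a'⁰) a'¹` where `s a' = a'⁰ ⊗ a'¹`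
  let g : A →ₗ[k] coinvAlg k H A ⊗[k] A →ₗ[k] A :=
    LinearMap.mk₂ k (fun a t => mulB k H A
        ((q ∘ₗ LinearMap.mulLeft k a ∘ₗ (coinvAlg k H A).val.toLinearMap).rTensor A t))
      (fun a a' t => by
        induction t with
        | zero => simp
        | add x y hx hy => simp only [map_add, hx, hy]; abel
        | tmul x y => simp [add_mul, TensorProduct.add_tmul])
      (fun c a t => by
        induction t with
        | zero => simp
        | add x y hx hy => simp only [map_add, hx, hy, smul_add]
        | tmul x y => simp [← TensorProduct.smul_tmul'])
      (fun a t t' => by simp)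
      (fun c a t => by simp)
  have g_tmul : ∀ a b a', g a (b ⊗ₜ a') = (q (a * b) : A) * a' := fun a b a' => by
    simp [g, mulB]
  let G : A ⊗[k] A →ₗ[k] A := TensorProduct.lift (g.compl₂ s)
  have hG : ∀ a a', G (a ⊗ₜ a') = g a (s a') := fun a a' => rfl
  -- Left `B`-linearity of `s` balances `G`: both `a b ⊗ a'` and `a ⊗ b a'` give `q(a b a'⁰) a'¹`.
  let Gbar : BalancedTensor k H A →ₗ[k] A := (balancing k H A).liftQ G (by
    rw [balancing, Submodule.span_le]
    rintro _ ⟨a, a', b, rfl⟩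
    simp only [SetLike.mem_coe, LinearMap.mem_ker, map_sub, hG, hs1, sub_eq_zero]
    induction s a' with
    | zero => simp
    | add x y hx hy => simp only [map_add, smul_add, hx, hy]
    | tmul x y => simp [TensorProduct.smul_tmul', g_tmul, mul_assoc])
  let e := LinearEquiv.ofBijective (can k H A) hA.hopfGalois
  let J : A ⊗[k] H →ₗ[k] A := Gbar ∘ₗ e.symm.toLinearMap
  have hJ : ∀ t, J (canLift k H A t) = G t := by
    intro t
    have h1 : e.symm (canLift k H A t) = (balancing k H A).mkQ t := by
      rw [LinearEquiv.symm_apply_eq]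
      rfl
    simp only [J, LinearMap.comp_apply, LinearEquiv.coe_coe, h1]
    rfl
  have hJ' : J ∘ₗ canLift k H A = G := LinearMap.ext hJ
  have canLift_tmul : ∀ a a', canLift k H A (a ⊗ₜ a') = (a ⊗ₜ 1) * coact k H a' := fun _ _ => rfl
  -- `id ⊗ ϱ` on `A ⊗ A`
  let r : A ⊗[k] A →ₗ[k] (A ⊗[k] A) ⊗[k] H :=
    (TensorProduct.assoc k A A H).symm.toLinearMap ∘ₗ (coact k H).lTensor A
  -- `s` is colinear and `q` takes values in `B`, so multiplying by its values on the left commutes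
  -- with the coaction.
  have hGr : ∀ t, coact k H (G t) = G.rTensor H (r t) := by
    have key : ∀ a, ∀ t : coinvAlg k H A ⊗[k] A,
        coact k H (g a t) = (g a).rTensor H (coactBA k H A t) := by
      intro a t
      induction t with
      | zero => simp
      | add x y hx hy => simp only [map_add, hx, hy]
      | tmul b a' =>
        rw [g_tmul, coact_coinv_mul]
        simp only [coactBA, LinearMap.comp_apply, LinearMap.lTensor_tmul, LinearEquiv.coe_coe]
        induction coact k H a' with
        | zero => simp
        | add x y hx hy => simp only [map_add, mul_add, TensorProduct.tmul_add, hx, hy]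
        | tmul x y => simp [g_tmul]
    intro t
    induction t with
    | zero => simp
    | add x y hx hy => simp only [map_add, hx, hy]
    | tmul a a' =>
      rw [hG, key, hs2]
      simp only [r, LinearMap.comp_apply, LinearMap.lTensor_tmul, LinearEquiv.coe_coe]
      induction coact k H a' with
      | zero => simp
      | add x y hx hy => simp only [map_add, TensorProduct.tmul_add, hx, hy]
      | tmul x y => simp [hG]
  -- The canonical map is colinear from `id ⊗ ϱ` to `id ⊗ Δ`, by coassociativity.
  have hcan : ∀ t, (TensorProduct.assoc k A H H).symm
      (Coalgebra.comul.lTensor A (canLift k H A t)) = (canLift k H A).rTensor H (r t) := by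
    intro t
    induction t with
    | zero => simp
    | add x y hx hy => simp only [map_add, hx, hy]
    | tmul a a' =>
      rw [LinearEquiv.symm_apply_eq]
      have h1 : ∀ t : A ⊗[k] H, Coalgebra.comul.lTensor A ((a ⊗ₜ[k] (1 : H)) * t) =
          (a ⊗ₜ[k] (1 : H ⊗[k] H)) * Coalgebra.comul.lTensor A t := by
        intro t
        induction t with
        | zero => simp
        | add x y hx hy => simp only [map_add, mul_add, hx, hy]
        | tmul x y => simp
      rw [canLift_tmul, h1, ← RightComodule.coassoc]
      simp only [r, LinearMap.comp_apply, LinearMap.lTensor_tmul, LinearEquiv.coe_coe]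
      induction coact k H a' with
      | zero => simp
      | add x y hx hy => simp only [map_add, mul_add, TensorProduct.tmul_add, hx, hy]
      | tmul x y =>
        simp only [LinearMap.rTensor_tmul, TensorProduct.assoc_symm_tmul, canLift_tmul]
        induction coact k H x with
        | zero => simp
        | add x y hx hy => simp only [map_add, mul_add, TensorProduct.add_tmul, hx, hy]
        | tmul x z => simp
  -- Surjectivity of `can` reduces colinearity of `J` to elements `a ϱ(a')`, where `J` is `G`.
  have hJco : ∀ x, coact k H (J x) =
      J.rTensor H ((TensorProduct.assoc k A H H).symm (Coalgebra.comul.lTensor A x)) := by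
    intro x
    obtain ⟨y, rfl⟩ := hA.hopfGalois.2 x
    obtain ⟨t, rfl⟩ := (balancing k H A).mkQ_surjective y
    change coact k H (J (canLift k H A t)) = J.rTensor H ((TensorProduct.assoc k A H H).symm
      (Coalgebra.comul.lTensor A (canLift k H A t)))
    rw [hJ, hGr, hcan, ← LinearMap.rTensor_comp_apply, hJ']
  refine ⟨J ∘ₗ TensorProduct.mk k A H 1, ?_, fun h => ?_⟩
  · have h1 : (1 : A) ⊗ₜ[k] (1 : H) = canLift k H A (1 ⊗ₜ 1) := by
      rw [canLift_tmul, IsComoduleAlgebra.coact_one, mul_one]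
    rw [LinearMap.comp_apply, TensorProduct.mk_apply, h1, hJ, hG]
    -- With first argument `1`, `q` only sees elements of `B` and disappears; hence `j 1 = μ(s 1) =
    -- 1`.
    have h2 : ∀ t, g 1 t = mulB k H A t := by
      intro t
      induction t with
      | zero => simp
      | add x y hx hy => simp only [map_add, hx, hy]
      | tmul x y => simp [g_tmul, hq, mulB]
    rw [h2, hs3]
  · rw [LinearMap.comp_apply, hJco, TensorProduct.mk_apply, LinearMap.lTensor_tmul]
    induction Coalgebra.comul (R := k) h with
    | zero => simp
    | add x y hx hy => simp only [map_add, TensorProduct.tmul_add, hx, hy]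
    | tmul x y => simp

end ComoduleAlgebra

/-! ### Diagonal coaction and outer multiplication -/

section DiagonalCoaction

variable {k H A : Type*} [Field k] [Ring H] [HopfAlgebra k H] [Ring A] [Algebra k A]

/-- The factors in `H` are multiplied in the order of the legs, so a right factor of the last leg
contributes the last factor in `H`. `diagPair_mul_left` is the mirror image on the first leg. -/
theorem diagPair_mul_right (p q r : A ⊗[k] H) :
    diagPair k H A p (q * r) =
      diagPair k H A p q * (TensorProduct.mk k A A 1).rTensor H r := by
  induction r with
  | zero => simp
  | add r r' hr hr' => simp only [map_add, mul_add, hr, hr']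
  | tmul c z =>
    induction p with
    | zero => simp
    | add p p' hp hp' => simp only [map_add, LinearMap.add_apply, add_mul, hp, hp']
    | tmul a x =>
      induction q with
      | zero => simp
      | add q q' hq hq' => simp only [map_add, add_mul, hq, hq']
      | tmul b y => simp [diagPair_tmul, mul_assoc]

theorem diagPair_mul_left (p q r : A ⊗[k] H) :
    diagPair k H A (p * q) r =
      ((TensorProduct.mk k A A).flip 1).rTensor H p * diagPair k H A q r := by
  induction r with
  | zero => simp
  | add r r' hr hr' => simp only [map_add, mul_add, hr, hr']
  | tmul c z =>
    induction p with
    | zero => simp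
    | add p p' hp hp' => simp only [map_add, LinearMap.add_apply, add_mul, hp, hp']
    | tmul a x =>
      induction q with
      | zero => simp
      | add q q' hq hq' => simp only [map_add, mul_add, LinearMap.add_apply, hq, hq']
      | tmul b y => simp [diagPair_tmul, mul_assoc]

theorem rTensor_mulLeft_tmul_one (x : A ⊗[k] A) (t : (A ⊗[k] A) ⊗[k] H) :
    (LinearMap.mulLeft k x).rTensor H t = (x ⊗ₜ[k] (1 : H)) * t := by
  induction t with
  | zero => simp
  | add t t' h h' => simp only [map_add, mul_add, h, h']
  | tmul y h => simp

variable [RightComodule k H A] [IsComoduleAlgebra k H A]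

theorem diagCoact_mul_right (t : A ⊗[k] A) (a : A) :
    diagCoact k H A (t * (1 ⊗ₜ a)) =
      diagCoact k H A t * (TensorProduct.mk k A A 1).rTensor H (coact k H a) := by
  induction t with
  | zero => simp
  | add x y hx hy => simp only [map_add, add_mul, hx, hy]
  | tmul x y =>
    rw [Algebra.TensorProduct.tmul_mul_tmul, mul_one, diagCoact_tmul, diagCoact_tmul,
      IsComoduleAlgebra.coact_mul, diagPair_mul_right]

theorem diagCoact_coinv_mul (b : coinvAlg k H A) (t : A ⊗[k] A) :
    diagCoact k H A (((b : A) ⊗ₜ 1) * t) =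
      (((b : A) ⊗ₜ[k] (1 : A)) ⊗ₜ[k] (1 : H)) * diagCoact k H A t := by
  have hb : coact k H (b : A) = (b : A) ⊗ₜ[k] (1 : H) := b.2
  induction t with
  | zero => simp
  | add x y hx hy => simp only [map_add, mul_add, hx, hy]
  | tmul x y =>
    rw [Algebra.TensorProduct.tmul_mul_tmul, one_mul, diagCoact_tmul, diagCoact_tmul,
      IsComoduleAlgebra.coact_mul, diagPair_mul_left, hb]
    rfl

end DiagonalCoaction

/-! ### Colinearity on generators -/

section Generators

variable {k H A : Type*} [Field k] [Ring H] [HopfAlgebra k H]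
  [Ring A] [Algebra k A] [RightComodule k H A]

/-- Colinearity of right `A`-linear maps can be checked on generators. -/
theorem isColinear_of_span {M N : Type*} [AddCommGroup M] [Module k M] [Module Aᵐᵒᵖ M]
    [IsScalarTower k Aᵐᵒᵖ M] [RightComodule k H M] [IsHopfModule k H A M]
    [AddCommGroup N] [Module k N] [Module Aᵐᵒᵖ N]
    [IsScalarTower k Aᵐᵒᵖ N] [RightComodule k H N] [IsHopfModule k H A N]
    (g : M →ₗ[Aᵐᵒᵖ] N) {S : Set M} (hS : Submodule.span Aᵐᵒᵖ S = ⊤)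
    (h : ∀ x ∈ S, coact k H (g x) = (g.restrictScalars k).rTensor H (coact k H x)) :
    IsColinear k H (g.restrictScalars k) := by
  intro x
  have hx : x ∈ Submodule.span Aᵐᵒᵖ S := hS ▸ Submodule.mem_top
  rw [LinearMap.restrictScalars_apply]
  induction hx using Submodule.span_induction with
  | mem x hx => exact h x hx
  | zero => simp
  | add x y _ _ hx hy => simp only [map_add, hx, hy]
  | smul a x _ hx =>
    -- Right `A`-linearity of `g` makes `g ⊗ id` intertwine the diagonal actions of `A ⊗ H`.
    have h1 : (diagAct k H A M).compr₂ ((g.restrictScalars k).rTensor H) =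
        (diagAct k H A N).compl₁₂ ((g.restrictScalars k).rTensor H) LinearMap.id := by
      refine bilin_ext fun x h b y => ?_
      simp [diagAct, rightAct]
    have e1 := LinearMap.congr_fun (LinearMap.congr_fun h1 (coact k H x)) (coact k H a.unop)
    simp only [LinearMap.compr₂_apply, LinearMap.compl₁₂_apply, LinearMap.id_apply] at e1
    rw [map_smul, ← op_unop a, IsHopfModule.coact_smul, IsHopfModule.coact_smul, hx, e1]

end Generators

/-! ### Unital splittings and the horizontal retraction -/

section Retraction

variable {k H A : Type*} [Field k] [Ring H] [HopfAlgebra k H]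
  [Ring A] [Algebra k A] [RightComodule k H A] [IsComoduleAlgebra k H A]

variable (k H A) in
/-- The inclusion `B ⊗ A → A ⊗ A`. -/
noncomputable def inclBA : coinvAlg k H A ⊗[k] A →ₐ[k] A ⊗[k] A :=
  Algebra.TensorProduct.map (coinvAlg k H A).val (AlgHom.id k A)

theorem inclBA_tmul (b : coinvAlg k H A) (a : A) :
    inclBA k H A (b ⊗ₜ a) = (b : A) ⊗ₜ a := rfl

theorem inclBA_smul (b : coinvAlg k H A) (t : coinvAlg k H A ⊗[k] A) :
    inclBA k H A (b • t) = ((b : A) ⊗ₜ 1) * inclBA k H A t := by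
  induction t with
  | zero => simp
  | add x y hx hy => simp only [map_add, smul_add, mul_add, hx, hy]
  | tmul x y => simp [TensorProduct.smul_tmul', inclBA_tmul]

theorem mul'_inclBA (t : coinvAlg k H A ⊗[k] A) :
    LinearMap.mul' k A (inclBA k H A t) = mulB k H A t := by
  induction t with
  | zero => simp
  | add x y hx hy => simp only [map_add, hx, hy]
  | tmul x y => rfl

/-- The first leg is coinvariant and adds only the factor `1` in `H`. Colinearity of `s` thus
becomes colinearity for the diagonal coaction on `A ⊗ A`. -/
theorem diagCoact_inclBA (t : coinvAlg k H A ⊗[k] A) :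
    diagCoact k H A (inclBA k H A t) =
      (inclBA k H A).toLinearMap.rTensor H (coactBA k H A t) := by
  induction t with
  | zero => simp
  | add x y hx hy => simp only [map_add, hx, hy]
  | tmul b a =>
    have hb : coact k H (b : A) = (b : A) ⊗ₜ[k] (1 : H) := b.2
    rw [inclBA_tmul, diagCoact_tmul, hb]
    simp only [coactBA, LinearMap.comp_apply, LinearMap.lTensor_tmul, LinearEquiv.coe_coe]
    induction coact k H a with
    | zero => simp
    | add x y hx hy => simp only [map_add, TensorProduct.tmul_add, hx, hy]
    | tmul x y => simp [diagPair_tmul, inclBA_tmul]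

/-- For a principal comodule algebra the splitting `A → B ⊗ A ⊆ A ⊗ A` of the multiplication can
be chosen to be unital. -/
theorem IsPrincipal.exists_unital_splitting (hA : IsPrincipal k H A) :
    ∃ s : A →ₗ[k] coinvAlg k H A ⊗[k] A,
      (∀ (b : coinvAlg k H A) (a : A),
        inclBA k H A (s ((b : A) * a)) = ((b : A) ⊗ₜ 1) * inclBA k H A (s a)) ∧
      (∀ a, diagCoact k H A (inclBA k H A (s a)) =
        ((inclBA k H A).toLinearMap ∘ₗ s).rTensor H (coact k H a)) ∧
      (∀ a, mulB k H A (s a) = a) ∧ inclBA k H A (s 1) = 1 := by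
  obtain ⟨s, hs1, hs2, hs3⟩ := hA.equivariantlyProjective
  obtain ⟨j, hj1, hj2⟩ := hA.exists_totalIntegral
  -- `E(a) = a₀ j(S a₁)`. Unlike `q`, this map is known to be left `B`-linear, which the correction
  -- term requires.
  let E : A →ₗ[k] coinvAlg k H A :=
    (coactConv LinearMap.id (j ∘ₗ HopfAlgebra.antipode k)).codRestrict
      (Subalgebra.toSubmodule (coinvAlg k H A)) (coactConv_antipode_mem j hj2)
  have hE1 : E 1 = 1 := by
    apply Subtype.ext
    change coactConv LinearMap.id (j ∘ₗ HopfAlgebra.antipode k) 1 = 1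
    simp [coactConv, IsComoduleAlgebra.coact_one, Algebra.TensorProduct.one_def, hj1]
  have hE2 : ∀ (b : coinvAlg k H A) (a : A), E ((b : A) * a) = b * E a := fun b a =>
    Subtype.ext (coactConv_id_coinv_mul _ b a)
  -- the failure of `s` to be unital, corrected by `a ↦ E(a₍₀₎) e j(a₍₁₎)`
  let e : coinvAlg k H A ⊗[k] A := s 1 - 1
  have he1 : mulB k H A e = 0 := by
    rw [map_sub, hs3, Algebra.TensorProduct.one_def]
    simp [mulB]
  -- Both `s 1` and `1 ⊗ 1` are coinvariant, since `ϱ 1 = 1 ⊗ 1` and `s` is colinear.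
  have he2 : diagCoact k H A (inclBA k H A e) = inclBA k H A e ⊗ₜ 1 := by
    have h1 : diagCoact k H A 1 = 1 := by
      rw [Algebra.TensorProduct.one_def, diagCoact_tmul, IsComoduleAlgebra.coact_one,
        Algebra.TensorProduct.one_def, diagPair_tmul, mul_one]
      rfl
    rw [map_sub, map_sub, diagCoact_inclBA, hs2, IsComoduleAlgebra.coact_one,
      map_one (inclBA k H A), h1, TensorProduct.sub_tmul,
      Algebra.TensorProduct.one_def (A := A) (B := H), LinearMap.rTensor_tmul,
      LinearMap.rTensor_tmul]
    rfl
  let Z : A ⊗[k] H →ₗ[k] coinvAlg k H A ⊗[k] A := TensorProduct.lift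
    ((LinearMap.mul k (coinvAlg k H A ⊗[k] A)).compl₁₂
      (LinearMap.mulRight k e ∘ₗ (TensorProduct.mk k (coinvAlg k H A) A).flip 1 ∘ₗ E)
      (TensorProduct.mk k (coinvAlg k H A) A 1 ∘ₗ j))
  have hZ : ∀ a h, Z (a ⊗ₜ h) = (E a ⊗ₜ 1) * e * (1 ⊗ₜ j h) := fun a h => rfl
  have hZ' : ∀ a h, inclBA k H A (Z (a ⊗ₜ h)) =
      ((E a : A) ⊗ₜ 1) * inclBA k H A e * (1 ⊗ₜ j h) := fun a h => by
    rw [hZ, map_mul, map_mul, inclBA_tmul, inclBA_tmul]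
    rfl
  have hZ0 : ∀ t, mulB k H A (Z t) = 0 := by
    intro t
    induction t with
    | zero => simp
    | add x y hx hy => simp only [map_add, hx, hy, add_zero]
    | tmul a h =>
      rw [← mul'_inclBA, hZ', mul'_right, mul'_left, mul'_inclBA, he1, mul_zero, zero_mul]
  have hZ1 : ∀ (b : coinvAlg k H A) t, inclBA k H A (Z (((b : A) ⊗ₜ 1) * t)) =
      ((b : A) ⊗ₜ 1) * inclBA k H A (Z t) := by
    intro b t
    induction t with
    | zero => simp
    | add x y hx hy => simp only [map_add, mul_add, hx, hy]
    | tmul a h =>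
      rw [Algebra.TensorProduct.tmul_mul_tmul, one_mul, hZ', hZ', hE2]
      simp only [← mul_assoc, Algebra.TensorProduct.tmul_mul_tmul, mul_one]
      rfl
  -- `E(a) e` is coinvariant and `j` is colinear, so `Z(a ⊗ h)` has coaction `Z(a ⊗ h₁) ⊗ h₂`.
  -- Coassociativity then makes `Z ∘ ϱ` colinear.
  have hZ2 : ∀ t, diagCoact k H A (inclBA k H A (Z t)) =
      ((inclBA k H A).toLinearMap ∘ₗ Z).rTensor H ((TensorProduct.assoc k A H H).symm
        (Coalgebra.comul.lTensor A t)) := by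
    intro t
    induction t with
    | zero => simp
    | add x y hx hy => simp only [map_add, hx, hy]
    | tmul a h =>
      rw [hZ', diagCoact_mul_right, diagCoact_coinv_mul, he2, hj2, LinearMap.lTensor_tmul]
      induction Coalgebra.comul (R := k) h with
      | zero => simp
      | add x y hx hy => simp only [map_add, mul_add, TensorProduct.tmul_add, hx, hy]
      | tmul x y => simp [hZ']
  refine ⟨s - Z ∘ₗ coact k H, fun b a => ?_, fun a => ?_, fun a => ?_, ?_⟩
  · simp only [LinearMap.sub_apply, LinearMap.comp_apply, map_sub, hs1, coact_coinv_mul, hZ1,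
      inclBA_smul, mul_sub]
  · simp only [LinearMap.sub_apply, LinearMap.comp_apply, map_sub, hZ2, diagCoact_inclBA, hs2,
      LinearMap.comp_sub, LinearMap.rTensor_sub, ← RightComodule.coassoc,
      LinearEquiv.symm_apply_apply, ← LinearMap.rTensor_comp_apply, LinearMap.comp_assoc]
  · simp only [LinearMap.sub_apply, LinearMap.comp_apply, map_sub, hs3, hZ0, sub_zero]
  -- At `1` the correction is `E(1) e j(1) = e`, and `s 1 - e = 1`.
  · rw [LinearMap.sub_apply, LinearMap.comp_apply, IsComoduleAlgebra.coact_one,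
      Algebra.TensorProduct.one_def, hZ, hj1, hE1, ← Algebra.TensorProduct.one_def,
      one_mul, mul_one]
    simp [e]

variable (k H A) in
/-- The map `b ⊗ a ↦ - d(b) a`, which is the identity on `ker (B ⊗ A → A)`. -/
noncomputable def toHorizontal : coinvAlg k H A ⊗[k] A →ₗ[k] HForms k H A :=
  -TensorProduct.lift ((rightAct k A (HForms k H A)) ∘ₗ baseToHorizontal k H A ∘ₗ
    univD k (coinvAlg k H A))

theorem incl_univD (a : A) : UForms.incl k A (univD k A a) = 1 ⊗ₜ a - a ⊗ₜ 1 := rfl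

theorem formsOfBase_univD (b : coinvAlg k H A) :
    formsOfBase k H A (univD k (coinvAlg k H A) b) = univD k A (b : A) := by
  apply UForms.ext
  change TensorProduct.map (coinvAlg k H A).val.toLinearMap (coinvAlg k H A).val.toLinearMap
    (UForms.incl k _ (univD k _ b)) = _
  rw [incl_univD, incl_univD]
  simp

/-- `-d(b) a = b ⊗ a - 1 ⊗ b a`. The second term vanishes on `ker (B ⊗ A → A)`, which therefore lies
in `Ω¹_u(B) A`. -/
theorem incl_toHorizontal (t : coinvAlg k H A ⊗[k] A) :
    UForms.incl k A (toHorizontal k H A t : UForms k A) =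
      inclBA k H A t - 1 ⊗ₜ mulB k H A t := by
  induction t with
  | zero => simp
  | add x y hx hy =>
    simp only [map_add, Submodule.coe_add, TensorProduct.tmul_add, hx, hy]
    abel
  | tmul b a =>
    have : (toHorizontal k H A (b ⊗ₜ a) : UForms k A) = -(op a • univD k A (b : A)) := by
      rw [← formsOfBase_univD]
      rfl
    rw [this, map_neg, UForms.incl_op_smul, incl_univD, inclBA_tmul]
    simp [sub_mul, mulB]

theorem rTensor_coact_hForms (x : HForms k H A) :
    ((horizontal k H A).subtype.restrictScalars k).rTensor H (coact k H x) =
      coact k H (x : UForms k A) :=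
  rTensor_restrictCoact _ _ _ _ x

/-- By flatness over the field, identities in `Ω¹_u(B) A ⊗ H` may be tested in `Ω¹_u(A) ⊗ H`. -/
theorem rTensor_subtype_injective : Function.Injective
    (((horizontal k H A).subtype.restrictScalars k).rTensor H) :=
  Module.Flat.rTensor_preserves_injective_linearMap (M := H) _ Subtype.val_injective

instance : IsHopfModule k H A (HForms k H A) where
  coact_smul x a := by
    apply rTensor_subtype_injective
    have h1 : (diagAct k H A (HForms k H A)).compr₂
        (((horizontal k H A).subtype.restrictScalars k).rTensor H) =
        (diagAct k H A (UForms k A)).compl₁₂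
          (((horizontal k H A).subtype.restrictScalars k).rTensor H) LinearMap.id := by
      refine bilin_ext fun x h b g => ?_
      simp [diagAct, rightAct]
    have e1 := LinearMap.congr_fun (LinearMap.congr_fun h1 (coact k H x)) (coact k H a)
    simp only [LinearMap.compr₂_apply, LinearMap.compl₁₂_apply, LinearMap.id_apply] at e1
    rw [e1, rTensor_coact_hForms, rTensor_coact_hForms, ← IsHopfModule.coact_smul]
    rfl

theorem coact_coinv_smul (b : coinvAlg k H A) (x : UForms k A) :
    coact k H ((b : A) • x) = (DistribSMul.toLinearMap k (UForms k A) (b : A)).rTensor H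
      (coact k H x) := by
  apply Module.Flat.rTensor_preserves_injective_linearMap (M := H) _ (UForms.incl_injective k A)
  have h : UForms.incl k A ∘ₗ DistribSMul.toLinearMap k (UForms k A) (b : A) =
      LinearMap.mulLeft k ((b : A) ⊗ₜ 1) ∘ₗ UForms.incl k A := rfl
  rw [UForms.incl_coact, UForms.incl_smul, diagCoact_coinv_mul, ← UForms.incl_coact,
    ← LinearMap.rTensor_comp_apply, h, LinearMap.rTensor_comp_apply, rTensor_mulLeft_tmul_one]

variable (k H A) in
theorem isRelativeBimodule_uForms : IsRelativeBimodule k H A (UForms k A) :=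
  ⟨inferInstance, coact_coinv_smul⟩

variable (k H A) in
theorem isRelativeBimodule_hForms : IsRelativeBimodule k H A (HForms k H A) := by
  refine ⟨inferInstance, fun b x => ?_⟩
  apply rTensor_subtype_injective
  have h : ((horizontal k H A).subtype.restrictScalars k) ∘ₗ
      DistribSMul.toLinearMap k (HForms k H A) b =
      DistribSMul.toLinearMap k (UForms k A) (b : A) ∘ₗ
        ((horizontal k H A).subtype.restrictScalars k) := rfl
  rw [rTensor_coact_hForms, ← LinearMap.rTensor_comp_apply, h, LinearMap.rTensor_comp_apply,
    rTensor_coact_hForms]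
  exact coact_coinv_smul b _

theorem IsPrincipal.exists_horizontalRetraction (hA : IsPrincipal k H A) :
    ∃ p : UForms k A →ₗ[Aᵐᵒᵖ] HForms k H A, IsHorizontalRetraction k H p := by
  obtain ⟨s, hs1, hs2, hs3, hs4⟩ := hA.exists_unital_splitting
  -- `P(a ⊗ a') = s(a) a'` on all of `A ⊗ A`; the retraction is its restriction to forms.
  let P : A ⊗[k] A →ₗ[k] coinvAlg k H A ⊗[k] A := TensorProduct.lift
    ((LinearMap.mul k (coinvAlg k H A ⊗[k] A)).compl₁₂ s (TensorProduct.mk k (coinvAlg k H A) A 1))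
  have hP : ∀ a a', inclBA k H A (P (a ⊗ₜ a')) = inclBA k H A (s a) * (1 ⊗ₜ a') := by
    intro a a'
    change inclBA k H A (s a * (1 ⊗ₜ a')) = _
    rw [map_mul, inclBA_tmul]
    rfl
  have hPmul : ∀ t, mulB k H A (P t) = LinearMap.mul' k A t := by
    intro t
    induction t with
    | zero => simp
    | add x y hx hy => simp only [map_add, hx, hy]
    | tmul a a' =>
      rw [← mul'_inclBA, hP, mul'_right, mul'_inclBA, hs3, LinearMap.mul'_apply]
  have hPl : ∀ (b : coinvAlg k H A) t, inclBA k H A (P (((b : A) ⊗ₜ 1) * t)) =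
      ((b : A) ⊗ₜ 1) * inclBA k H A (P t) := by
    intro b t
    induction t with
    | zero => simp
    | add x y hx hy => simp only [map_add, mul_add, hx, hy]
    | tmul a a' =>
      rw [Algebra.TensorProduct.tmul_mul_tmul, one_mul, hP, hP, hs1, mul_assoc]
  have hPr : ∀ (a : A) t, inclBA k H A (P (t * (1 ⊗ₜ a))) =
      inclBA k H A (P t) * (1 ⊗ₜ a) := by
    intro b t
    induction t with
    | zero => simp
    | add x y hx hy => simp only [map_add, add_mul, hx, hy]
    | tmul a a' =>
      rw [Algebra.TensorProduct.tmul_mul_tmul, mul_one, hP, hP, mul_assoc,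
        Algebra.TensorProduct.tmul_mul_tmul, one_mul]
  have hPco : ∀ t, diagCoact k H A (inclBA k H A (P t)) =
      ((inclBA k H A).toLinearMap ∘ₗ P).rTensor H (diagCoact k H A t) := by
    intro t
    induction t with
    | zero => simp
    | add x y hx hy => simp only [map_add, hx, hy]
    | tmul a a' =>
      rw [hP, diagCoact_mul_right, hs2, diagCoact_tmul]
      induction coact k H a with
      | zero => simp
      | add x y hx hy => simp only [map_add, add_mul, LinearMap.add_apply, hx, hy]
      | tmul x h =>
        induction coact k H a' with
        | zero => simp
        | add y z hy hz => simp only [map_add, mul_add, hy, hz]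
        | tmul y g => simp [diagPair_tmul, hP]
  -- `P` preserves products, so it maps forms into `ker (B ⊗ A → A)`, where `toHorizontal` changes
  -- nothing.
  have hp : ∀ x : UForms k A,
      UForms.incl k A (toHorizontal k H A (P (UForms.incl k A x)) : UForms k A) =
        inclBA k H A (P (UForms.incl k A x)) := by
    intro x
    rw [incl_toHorizontal, hPmul, UForms.mul_incl, TensorProduct.tmul_zero, sub_zero]
  let p : UForms k A →ₗ[Aᵐᵒᵖ] HForms k H A :=
    { toFun := fun x => toHorizontal k H A (P (UForms.incl k A x))
      map_add' := fun x y => by simp only [map_add]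
      map_smul' := fun a x => by
        apply Subtype.ext
        apply UForms.ext
        rw [hp, UForms.incl_op_smul, hPr, ← hp]
        rfl }
  have hp' : ∀ x, UForms.incl k A (p x : UForms k A) = inclBA k H A (P (UForms.incl k A x)) := hp
  refine ⟨p, ⟨fun b x => ?_, fun x => ?_⟩, fun x => ?_⟩
  · apply Subtype.ext
    apply UForms.ext
    refine (hp' _).trans ?_
    change inclBA k H A (P (((b : A) ⊗ₜ 1) * UForms.incl k A x)) =
      ((b : A) ⊗ₜ 1) * UForms.incl k A (p x : UForms k A)
    rw [hPl, hp']
  · apply rTensor_subtype_injective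
    apply Module.Flat.rTensor_preserves_injective_linearMap (M := H) _ (UForms.incl_injective k A)
    rw [rTensor_coact_hForms, UForms.incl_coact]
    have h1 : (UForms.incl k A ∘ₗ (horizontal k H A).subtype.restrictScalars k) ∘ₗ
        p.restrictScalars k =
        ((inclBA k H A).toLinearMap ∘ₗ P) ∘ₗ UForms.incl k A :=
      LinearMap.ext hp'
    rw [← LinearMap.rTensor_comp_apply, ← LinearMap.rTensor_comp_apply, h1,
      LinearMap.rTensor_comp_apply, UForms.incl_coact, ← hPco, LinearMap.restrictScalars_apply,
      hp']
  · apply Subtype.ext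
    obtain ⟨x, hx⟩ := x
    change (p x : UForms k A) = x
    induction hx using Submodule.span_induction with
    | mem x hx =>
      obtain ⟨y, rfl⟩ := hx
      apply UForms.ext
      rw [hp']
      change inclBA k H A (P (TensorProduct.map (coinvAlg k H A).val.toLinearMap
        (coinvAlg k H A).val.toLinearMap (UForms.incl k _ y))) =
        TensorProduct.map (coinvAlg k H A).val.toLinearMap (coinvAlg k H A).val.toLinearMap
          (UForms.incl k _ y)
      induction UForms.incl k _ y with
      | zero => simp
      | add x y hx hy => simp only [map_add, hx, hy]
      | tmul a b =>
        -- Unitality enters here: `s(b) = b s(1) = b ⊗ 1`, so `P` fixes `B ⊗ B`.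
        have h1 := hs1 a 1
        rw [mul_one, hs4, mul_one] at h1
        simp [hP, h1]
    | zero => simp
    | add x y _ _ hx hy => simp only [map_add, Submodule.coe_add, hx, hy]
    | smul a x _ hx => rw [map_smul, Submodule.coe_smul, hx]

end Retraction

/-! ### Universal forms generated by differentials -/

section Forms

/-- Every universal one-form `Σ aᵢ ⊗ aᵢ'` equals `- Σ d(aᵢ) aᵢ'`. -/
theorem eq_neg_lift_univD {k A : Type*} [Field k] [Ring A] [Algebra k A] (x : UForms k A) :
    x = -TensorProduct.lift (rightAct k A (UForms k A) ∘ₗ univD k A) (UForms.incl k A x) := by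
  apply UForms.ext
  -- On all of `A ⊗ A` the lift is `t ↦ 1 ⊗ μ(t) - t`, since `d(a) a' = 1 ⊗ a a' - a ⊗ a'`.
  have h : ∀ t, UForms.incl k A
      (TensorProduct.lift (rightAct k A (UForms k A) ∘ₗ univD k A) t) =
        1 ⊗ₜ LinearMap.mul' k A t - t := by
    intro t
    induction t with
    | zero => simp
    | add x y hx hy =>
      simp only [map_add, TensorProduct.tmul_add, hx, hy]
      abel
    | tmul a a' =>
      change UForms.incl k A (op a' • univD k A a) = _
      rw [UForms.incl_op_smul]
      change ((1 : A) ⊗ₜ[k] a - a ⊗ₜ[k] (1 : A)) * ((1 : A) ⊗ₜ[k] a') = _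
      simp [sub_mul]
  rw [map_neg, h, UForms.mul_incl, TensorProduct.tmul_zero, zero_sub, neg_neg]

end Forms

/-! ### Extension of maps and descent of hom-connections -/

section Extension

variable {k H A : Type*} [Field k] [Ring H] [HopfAlgebra k H]
  [Ring A] [Algebra k A] [RightComodule k H A] [IsComoduleAlgebra k H A]

theorem span_range_baseToHorizontal :
    Submodule.span Aᵐᵒᵖ (Set.range (baseToHorizontal k H A)) = ⊤ := by
  rw [eq_top_iff]
  rintro ⟨x, hx⟩ -
  induction hx using Submodule.span_induction with
  | mem x hx =>
    obtain ⟨y, rfl⟩ := hx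
    exact Submodule.subset_span ⟨y, rfl⟩
  | zero => exact zero_mem _
  | add x y hx' hy' hx hy => exact add_mem hx hy
  | smul a x hx' hx => exact Submodule.smul_mem _ a hx

/-- Both legs of a form over `B` are coinvariant. Thus `Ω¹_u(B) A` is generated over `A` by
coinvariants, where colinearity is easy to test. -/
theorem coact_baseToHorizontal (y : UForms k (coinvAlg k H A)) :
    coact k H (baseToHorizontal k H A y) = baseToHorizontal k H A y ⊗ₜ[k] (1 : H) := by
  apply rTensor_subtype_injective
  apply Module.Flat.rTensor_preserves_injective_linearMap (M := H) _ (UForms.incl_injective k A)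
  rw [rTensor_coact_hForms, UForms.incl_coact]
  have h : ∀ t : coinvAlg k H A ⊗[k] coinvAlg k H A,
      diagCoact k H A (TensorProduct.map (coinvAlg k H A).val.toLinearMap
        (coinvAlg k H A).val.toLinearMap t) = (TensorProduct.map (coinvAlg k H A).val.toLinearMap
        (coinvAlg k H A).val.toLinearMap t) ⊗ₜ 1 := by
    intro t
    induction t with
    | zero => simp
    | add x y hx hy => simp only [map_add, TensorProduct.add_tmul, hx, hy]
    | tmul a b =>
      have ha : coact k H (a : A) = (a : A) ⊗ₜ[k] (1 : H) := a.2
      have hb : coact k H (b : A) = (b : A) ⊗ₜ[k] (1 : H) := b.2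
      simp [diagCoact_tmul, ha, hb, diagPair_tmul]
  exact h _

variable {M : Type*} [AddCommGroup M] [Module k M] [Module Aᵐᵒᵖ M] [IsScalarTower k Aᵐᵒᵖ M]
  [RightComodule k H M]

theorem isColinear_comp_retraction {p : UForms k A →ₗ[Aᵐᵒᵖ] HForms k H A}
    (hp : IsHorizontalRetraction k H p) {g : HForms k H A →ₗ[Aᵐᵒᵖ] M}
    (hg : IsColinear k H (g.restrictScalars k)) :
    IsColinear k H ((g ∘ₗ p).restrictScalars k) := by
  intro x
  have h3 : (g ∘ₗ p).restrictScalars k = g.restrictScalars k ∘ₗ p.restrictScalars k := rfl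
  rw [h3, LinearMap.rTensor_comp_apply, ← hp.hom.colinear x, ← hg]
  rfl

variable [IsHopfModule k H A M]

theorem coe_op_smul_coinv (b : coinvAlg k H A) (m : coinv k H M) :
    ((op b • m : coinv k H M) : M) = op (b : A) • (m : M) := rfl

/-- The extension `Σ aᵢ ⊗ aᵢ' ↦ - Σ f(d q(aᵢ)) aᵢ'` of a right `B`-linear map
`f : Ω¹_u(B) → M^{coH}`, along a linear projection `q` of `A` onto `B`. -/
noncomputable def extendHom (q : A →ₗ[k] coinvAlg k H A)
    (f : UForms k (coinvAlg k H A) →ₗ[(coinvAlg k H A)ᵐᵒᵖ] coinv k H M) :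
    HForms k H A →ₗ[Aᵐᵒᵖ] M where
  -- Thanks to `q` the formula makes sense on all of `A ⊗ A` before restriction, so no
  -- well-definedness on `Ω¹_u(B) A` has to be checked.
  toFun x := -TensorProduct.lift (rightAct k A M ∘ₗ (coinv k H M).subtype ∘ₗ
    f.restrictScalars k ∘ₗ univD k (coinvAlg k H A) ∘ₗ q) (UForms.incl k A (x : UForms k A))
  map_add' x y := by simp only [Submodule.coe_add, map_add, neg_add]
  map_smul' a x := by
    rw [Submodule.coe_smul, UForms.incl_op_smul, RingHom.id_apply, smul_neg]
    congr 1
    induction UForms.incl k A (x : UForms k A) with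
    | zero => simp
    | add x y hx hy => simp only [map_add, add_mul, smul_add, hx, hy]
    | tmul x y => simp [rightAct, mul_smul]

theorem extendHom_apply (q : A →ₗ[k] coinvAlg k H A)
    (f : UForms k (coinvAlg k H A) →ₗ[(coinvAlg k H A)ᵐᵒᵖ] coinv k H M) (x : HForms k H A) :
    extendHom q f x = -TensorProduct.lift (rightAct k A M ∘ₗ (coinv k H M).subtype ∘ₗ
      f.restrictScalars k ∘ₗ univD k (coinvAlg k H A) ∘ₗ q)
        (UForms.incl k A (x : UForms k A)) := rfl

/-- On `B` the projection is the identity; right `B`-linearity of `f` applied to `ω = -Σ d(bᵢ) bᵢ'`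
gives the formula. -/
theorem extendHom_baseToHorizontal {q : A →ₗ[k] coinvAlg k H A}
    (hq : ∀ b : coinvAlg k H A, q b = b)
    (f : UForms k (coinvAlg k H A) →ₗ[(coinvAlg k H A)ᵐᵒᵖ] coinv k H M)
    (ω : UForms k (coinvAlg k H A)) :
    extendHom q f (baseToHorizontal k H A ω) = f ω := by
  rw [extendHom_apply]
  conv_rhs => rw [eq_neg_lift_univD ω, map_neg, Submodule.coe_neg]
  congr 1
  change TensorProduct.lift _ (TensorProduct.map (coinvAlg k H A).val.toLinearMap
    (coinvAlg k H A).val.toLinearMap (UForms.incl k _ ω)) = _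
  induction UForms.incl k _ ω with
  | zero => simp
  | add x y hx hy => simp only [map_add, Submodule.coe_add, hx, hy]
  | tmul a b => simp [rightAct, hq, coe_op_smul_coinv]

theorem IsHopfExtension.unique
    {f : UForms k (coinvAlg k H A) →ₗ[(coinvAlg k H A)ᵐᵒᵖ] coinv k H M}
    {g g' : HForms k H A →ₗ[Aᵐᵒᵖ] M} (hg : IsHopfExtension k H A f g)
    (hg' : IsHopfExtension k H A f g') : g = g' := by
  refine LinearMap.ext_on span_range_baseToHorizontal ?_
  rintro _ ⟨ω, rfl⟩
  rw [hg.extends_base, hg'.extends_base]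

theorem isHopfExtension_extendHom {q : A →ₗ[k] coinvAlg k H A}
    (hq : ∀ b : coinvAlg k H A, q b = b)
    (f : UForms k (coinvAlg k H A) →ₗ[(coinvAlg k H A)ᵐᵒᵖ] coinv k H M) :
    IsHopfExtension k H A f (extendHom q f) := by
  refine ⟨isColinear_of_span _ span_range_baseToHorizontal ?_, extendHom_baseToHorizontal hq f⟩
  rintro _ ⟨ω, rfl⟩
  have h : coact k H (f ω : M) = (f ω : M) ⊗ₜ[k] (1 : H) := (f ω).2
  rw [coact_baseToHorizontal, LinearMap.rTensor_tmul, LinearMap.restrictScalars_apply,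
    extendHom_baseToHorizontal hq, h]

/-- The extension of `f b` is `ω ↦ f̂ (b ω)`. -/
theorem IsHopfExtension.homAct
    {f : UForms k (coinvAlg k H A) →ₗ[(coinvAlg k H A)ᵐᵒᵖ] coinv k H M}
    {g : HForms k H A →ₗ[Aᵐᵒᵖ] M} (hg : IsHopfExtension k H A f g) (b : coinvAlg k H A) :
    IsHopfExtension k H A (HopfGalois.homAct f b)
      (g ∘ₗ DistribSMul.toLinearMap Aᵐᵒᵖ (HForms k H A) b) := by
  refine ⟨fun x => ?_, fun ω => ?_⟩
  · have h := (isRelativeBimodule_hForms k H A).colinear b x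
    have h2 := hg.colinear (b • x)
    have h3 : (g ∘ₗ DistribSMul.toLinearMap Aᵐᵒᵖ (HForms k H A) b).restrictScalars k =
      g.restrictScalars k ∘ₗ DistribSMul.toLinearMap k (HForms k H A) b := rfl
    rw [h3, LinearMap.rTensor_comp_apply, ← h]
    exact h2
  · have h : b • baseToHorizontal k H A ω = baseToHorizontal k H A (b • ω) :=
      Subtype.ext (formsOfBase_smul b ω).symm
    change g (b • baseToHorizontal k H A ω) = f (b • ω)
    rw [h, hg.extends_base]

/-- The descended map `f ↦ ∇ (f̂ ∘ Π)`. -/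
noncomputable def descend {q : A →ₗ[k] coinvAlg k H A} (hq : ∀ b : coinvAlg k H A, q b = b)
    {p : UForms k A →ₗ[Aᵐᵒᵖ] HForms k H A} (hp : IsHorizontalRetraction k H p)
    (nabla : (UForms k A →ₗ[Aᵐᵒᵖ] M) →ₗ[k] M)
    (hn : ∀ f : UForms k A →ₗ[Aᵐᵒᵖ] M, IsColinear k H (f.restrictScalars k) →
      nabla f ∈ coinv k H M) :
    (UForms k (coinvAlg k H A) →ₗ[(coinvAlg k H A)ᵐᵒᵖ] coinv k H M) →ₗ[k] coinv k H M where
  toFun f := ⟨nabla (extendHom q f ∘ₗ p),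
    hn _ (isColinear_comp_retraction hp (isHopfExtension_extendHom hq f).colinear)⟩
  map_add' f g := by
    apply Subtype.ext
    -- Both sides are right `A`-linear and agree on the generating forms over `B`.
    have h : extendHom q (f + g) = extendHom q f + extendHom q g := by
      refine LinearMap.ext_on span_range_baseToHorizontal ?_
      rintro _ ⟨ω, rfl⟩
      simp [extendHom_baseToHorizontal hq]
    change nabla (extendHom q (f + g) ∘ₗ p) = nabla (extendHom q f ∘ₗ p) +
      nabla (extendHom q g ∘ₗ p)
    rw [h, LinearMap.add_comp, map_add]
  map_smul' c f := by
    apply Subtype.ext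
    have h : extendHom q (c • f) = c • extendHom q f := by
      refine LinearMap.ext_on span_range_baseToHorizontal ?_
      rintro _ ⟨ω, rfl⟩
      simp [extendHom_baseToHorizontal hq]
    change nabla (extendHom q (c • f) ∘ₗ p) = c • nabla (extendHom q f ∘ₗ p)
    rw [h, LinearMap.smul_comp, map_smul]

theorem isHomConnection_descend {q : A →ₗ[k] coinvAlg k H A}
    (hq : ∀ b : coinvAlg k H A, q b = b)
    {p : UForms k A →ₗ[Aᵐᵒᵖ] HForms k H A} (hp : IsHorizontalRetraction k H p)
    {nabla : (UForms k A →ₗ[Aᵐᵒᵖ] M) →ₗ[k] M} (hnabla : IsHomConnection (univD k A) nabla)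
    (hn : ∀ f : UForms k A →ₗ[Aᵐᵒᵖ] M, IsColinear k H (f.restrictScalars k) →
      nabla f ∈ coinv k H M) :
    IsHomConnection (univD k (coinvAlg k H A)) (descend hq hp nabla hn) := by
  intro f b
  apply Subtype.ext
  change nabla (extendHom q (homAct f b) ∘ₗ p) =
    op (b : A) • nabla (extendHom q f ∘ₗ p) + (f (univD k _ b) : M)
  -- Uniqueness identifies the extension of `f b` with `ω ↦ f̂(b ω)`; left `B`-linearity of `Π`
  -- moves `b` past it.
  have h1 : extendHom q (homAct f b) ∘ₗ p = homAct (extendHom q f ∘ₗ p) (b : A) := by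
    rw [(isHopfExtension_extendHom hq (homAct f b)).unique
      ((isHopfExtension_extendHom hq f).homAct b)]
    ext x
    exact congrArg (extendHom q f) (hp.hom.map_smul b x).symm
  -- `d b` already lies in `Ω¹_u(B) A`, so `Π` fixes it and the Leibniz term becomes `f(d b)`.
  have h2 : p (univD k A (b : A)) = baseToHorizontal k H A (univD k _ b) := by
    rw [← hp.retract (baseToHorizontal k H A (univD k _ b)), ← formsOfBase_univD]
    rfl
  rw [h1, hnabla, LinearMap.comp_apply, h2, extendHom_baseToHorizontal hq]

end Extension
end HopfGalois

theorem mainTheorem10 {k H A : Type*} [Field k] [Ring H] [HopfAlgebra k H]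
    [Ring A] [Algebra k A] [HopfGalois.RightComodule k H A] [HopfGalois.IsComoduleAlgebra k H A]
    (hA : HopfGalois.IsPrincipal k H A) :
    -- `Ω¹_u(B) A` is a direct summand of `Ω¹_u(A)` in `_B M_A^H`
    (HopfGalois.IsRelativeBimodule k H A (HopfGalois.UForms k A) ∧
      HopfGalois.IsRelativeBimodule k H A (HopfGalois.HForms k H A) ∧
      ∃ p : HopfGalois.UForms k A →ₗ[Aᵐᵒᵖ] HopfGalois.HForms k H A,
        HopfGalois.IsHorizontalRetraction k H p) ∧
    -- descent of hom-connections, along any retraction `p`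
    ∀ p : HopfGalois.UForms k A →ₗ[Aᵐᵒᵖ] HopfGalois.HForms k H A,
      HopfGalois.IsHorizontalRetraction k H p →
      ∀ {M : Type*} [AddCommGroup M] [Module k M] [Module Aᵐᵒᵖ M] [IsScalarTower k Aᵐᵒᵖ M]
        [HopfGalois.RightComodule k H M] [HopfGalois.IsHopfModule k H A M]
        (nabla : (HopfGalois.UForms k A →ₗ[Aᵐᵒᵖ] M) →ₗ[k] M),
        HopfGalois.IsHomConnection (HopfGalois.univD k A) nabla →
        (∀ f : HopfGalois.UForms k A →ₗ[Aᵐᵒᵖ] M,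
          HopfGalois.IsColinear k H (f.restrictScalars k) → nabla f ∈ HopfGalois.coinv k H M) →
        (∀ f : HopfGalois.UForms k (HopfGalois.coinvAlg k H A)
            →ₗ[(HopfGalois.coinvAlg k H A)ᵐᵒᵖ] HopfGalois.coinv k H M,
          ∃! g : HopfGalois.HForms k H A →ₗ[Aᵐᵒᵖ] M, HopfGalois.IsHopfExtension k H A f g) ∧
        ∃ nablaCo : (HopfGalois.UForms k (HopfGalois.coinvAlg k H A)
            →ₗ[(HopfGalois.coinvAlg k H A)ᵐᵒᵖ] HopfGalois.coinv k H M) →ₗ[k]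
            HopfGalois.coinv k H M,
          HopfGalois.IsHomConnection (HopfGalois.univD k (HopfGalois.coinvAlg k H A)) nablaCo ∧
          ∀ (f : HopfGalois.UForms k (HopfGalois.coinvAlg k H A)
              →ₗ[(HopfGalois.coinvAlg k H A)ᵐᵒᵖ] HopfGalois.coinv k H M)
            (g : HopfGalois.HForms k H A →ₗ[Aᵐᵒᵖ] M),
            HopfGalois.IsHopfExtension k H A f g → (nablaCo f : M) = nabla (g ∘ₗ p) := by
  refine ⟨⟨HopfGalois.isRelativeBimodule_uForms k H A, HopfGalois.isRelativeBimodule_hForms k H A,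
    hA.exists_horizontalRetraction⟩, ?_⟩
  intro p hp M _ _ _ _ _ _ nabla hnabla hn
  obtain ⟨q, hq⟩ := HopfGalois.exists_coinv_projection (k := k) (H := H) (A := A)
  refine ⟨fun f => ⟨HopfGalois.extendHom q f, HopfGalois.isHopfExtension_extendHom hq f,
    fun g hg => hg.unique (HopfGalois.isHopfExtension_extendHom hq f)⟩,
    HopfGalois.descend hq hp nabla hn, HopfGalois.isHomConnection_descend hq hp hnabla hn, ?_⟩
  intro f g hg
  -- By uniqueness of extensions the result does not depend on the auxiliary projection `q`.
  rw [hg.unique (HopfGalois.isHopfExtension_extendHom hq f)]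
  rfl
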